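/- Let $\mathrm{Ai}$ be the Airy function, $\mathrm{Ai}(x)=\frac1{2\pi i}\int_{1+i\mathbb R}e^{z^3/3-xz}\,dz$, and let $K_{\mathrm{Ai}}(x,y)=\int_0^\infty \mathrm{Ai}(x+s)\mathrm{Ai}(y+s)\,ds$ be the Airy kernel. For $\xi\in\mathbb R$ let $$F_2(\xi)=\det(\mathbf I-\mathbf K_{\mathrm{Ai},\xi})_{L^2(\mathbb R_+)}=\sum_{n\ge0}\frac{(-1)^n}{n!}\int_{\mathbb R_+^n}\det\big(K_{\mathrm{Ai}}(\xi+v_i,\xi+v_j)\big)_{i,j=1}^n\,d^nv$$ be the GUE Tracy–Widom distribution function. For $\xi_2,\eta_2\in\mathbb R$ put $$A_{2,\pm}(v)=\mathrm{Ai}(\xi_2+\eta_2^2+v)\,e^{\pm(\xi_2+v)\eta_2\pm\frac23\eta_2^3},\qquad A_{2,-}^{(1)}(v)=-\frac{d}{dv}A_{2,-}(v).$$ Let $\mathbf A_{2,\pm}$ be the operator on $L^2(\mathbb R_+)$ with kernel $A_{2,\pm}(v_1+v_2)$, let $\mathbf K_2=\mathbf A_{2,+}\mathbf A_{2,-}$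 with adjoint $\mathbf K_2^*$, and for functions $A,B$ on $\mathbb R_+$ let $A\otimes B$ be the operator with kernel $A(v_1)B(v_2)$. Define $$a_0(\xi_2,\eta_2)=\mathrm{tr}\,(\mathbf I-\mathbf K_2^*)^{-1}A_{2,-}\otimes A_{2,+},\qquad a_1(\xi_2,\eta_2)=\mathrm{tr}\,(\mathbf I-\mathbf K_2^*)^{-1}A_{2,-}^{(1)}\otimes A_{2,+}.$$ **Lemma.** $F_2$ is well defined, positive and twice differentiable on $\mathbb R$, and $a_0(\xi_2,\eta_2)$ and $a_1(\xi_2,0)$ are well defined for all real $\xi_2,\eta_2$: the integrals and the series above converge absolutely, $A_{2,-}$ is differentiable when $\eta_2=0$, the kernels above that enter these quantities are square integrable on $\mathbb R_+^2$, $\mathbf I-\mathbf K_2^*$ is invertible, and the traces exist. Moreover, for all $\xi_2,\eta_2\in\mathbb R$, $$a_0(\xi_2,\eta_2)=\frac{F_2'(\xi_2+\eta_2^2)}{F_2(\xi_2+\eta_2^2)}\qquad\text{and}\qquad a_1(\xi_2,0)=-\frac{F_2''(\xi_2)}{2F_2(\xi_2)}.$$ -/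

import Mathlib

open MeasureTheory Set

noncomputable section

/-! ## The Airy function -/

/-- The integrand `exp (z ^ 3 / 3 - x * z)` of the contour integral for `Ai x`, on the vertical
line `z = 1 + i t`. -/
def airyIntegrand (x t : ℝ) : ℂ :=
  Complex.exp ((1 + t * Complex.I) ^ 3 / 3 - x * (1 + t * Complex.I))

/-- The Airy function `Ai x = (1 / (2 π i)) ∫ exp (z ^ 3 / 3 - x z) dz`, integrated upwards over the
line `Re z = 1`. With `z = 1 + i t`, `dz = i dt` the factor in front is `1 / (2 π)`. The integral is
absolutely convergent and real (see the two lemmas below), so that `re` loses nothing. -/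
def airyAi (x : ℝ) : ℝ :=
  (1 / (2 * Real.pi)) * (∫ t : ℝ, airyIntegrand x t).re

theorem integrable_airyIntegrand (x : ℝ) : Integrable (airyIntegrand x) := by
  have hc : Continuous (airyIntegrand x) := by
    unfold airyIntegrand
    fun_prop
  have hg : Integrable (fun t : ℝ => Real.exp (1 / 3 - x) * Real.exp (-1 * t ^ 2)) :=
    (integrable_exp_neg_mul_sq one_pos).const_mul _
  refine hg.mono' hc.aestronglyMeasurable (Filter.Eventually.of_forall fun t => ?_)
  have h : ((1 + (t : ℂ) * Complex.I) ^ 3 / 3 - x * (1 + t * Complex.I))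
      = ((1 / 3 - t ^ 2 - x : ℝ) : ℂ) + ((t - t ^ 3 / 3 - x * t : ℝ) : ℂ) * Complex.I := by
    have hI : Complex.I ^ 3 = -Complex.I := by
      rw [pow_succ, Complex.I_sq]
      ring
    push_cast
    ring_nf
    rw [hI, Complex.I_sq]
    ring
  rw [airyIntegrand, Complex.norm_exp, h, ← Real.exp_add]
  apply le_of_eq
  congr 1
  simp only [Complex.add_re, Complex.ofReal_re, Complex.re_ofReal_mul, Complex.I_re]
  ring

theorem airyIntegral_im (x : ℝ) : (∫ t : ℝ, airyIntegrand x t).im = 0 := by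
  rw [← Complex.conj_eq_iff_im, ← integral_conj, ← integral_neg_eq_self]
  congr 1
  ext t
  simp [airyIntegrand, ← Complex.exp_conj, Complex.conj_ofNat]

/-! ## Integral operators on `L²(ℝ₊)` -/

/-- Lebesgue measure on `ℝ₊ = (0, ∞)`. -/
abbrev volPos : Measure ℝ := volume.restrict (Ioi 0)

/-- The Hilbert space `L²(ℝ₊)`. -/
abbrev L2Pos : Type := Lp ℝ 2 volPos

/-- The kernel `k` is square integrable on `ℝ₊ × ℝ₊` (a Hilbert-Schmidt kernel). -/
def IsHSKernel (k : ℝ → ℝ → ℝ) : Prop :=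
  MemLp (Function.uncurry k) 2 (volPos.prod volPos)

theorem IsHSKernel.ae_memLp {k : ℝ → ℝ → ℝ} (hk : IsHSKernel k) :
    ∀ᵐ x ∂volPos, MemLp (k x) 2 volPos := by
  have h2 : Integrable (fun p : ℝ × ℝ => (Function.uncurry k p) ^ 2) (volPos.prod volPos) :=
    hk.integrable_sq
  filter_upwards [hk.1.prodMk_left, h2.prod_right_ae] with x hx1 hx2
  exact (memLp_two_iff_integrable_sq hx1).2 hx2

theorem enorm_integral_mul_le {u v : ℝ → ℝ} (hu : AEStronglyMeasurable u volPos)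
    (hv : AEStronglyMeasurable v volPos) :
    ‖∫ y, u y * v y ∂volPos‖ₑ ≤ eLpNorm u 2 volPos * eLpNorm v 2 volPos := by
  have h : eLpNorm (u • v) 1 volPos ≤ eLpNorm u 2 volPos * eLpNorm v 2 volPos :=
    eLpNorm_smul_le_mul_eLpNorm (p := 2) (q := 2) hv hu
  rw [eLpNorm_one_eq_lintegral_enorm] at h
  exact (enorm_integral_le_lintegral_enorm _).trans h

theorem IsHSKernel.memLp_apply {k : ℝ → ℝ → ℝ} (hk : IsHSKernel k) (f : L2Pos) :
    MemLp (fun x => ∫ y, k x y * f y ∂volPos) 2 volPos ∧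
      eLpNorm (fun x => ∫ y, k x y * f y ∂volPos) 2 volPos ≤
        eLpNorm (Function.uncurry k) 2 (volPos.prod volPos) * eLpNorm f 2 volPos := by
  have hmeas : AEStronglyMeasurable (fun x => ∫ y, k x y * f y ∂volPos) volPos := by
    have h : AEStronglyMeasurable (fun p : ℝ × ℝ => Function.uncurry k p * f p.2)
        (volPos.prod volPos) := hk.1.mul (Lp.aestronglyMeasurable f).comp_snd
    exact h.integral_prod_right'
  have hsq : ∀ {α : Type} [MeasurableSpace α] (ν : Measure α) (g : α → ℝ),
      (eLpNorm g 2 ν) ^ 2 = ∫⁻ a, ‖g a‖ₑ ^ 2 ∂ν := by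
    intro α _ ν g
    have := eLpNorm_nnreal_pow_eq_lintegral (f := g) (μ := ν) (p := 2) (by norm_num)
    simpa using this
  have hpt : ∀ᵐ x ∂volPos, ‖∫ y, k x y * f y ∂volPos‖ₑ ^ 2 ≤
      (∫⁻ y, ‖k x y‖ₑ ^ 2 ∂volPos) * (eLpNorm f 2 volPos) ^ 2 := by
    filter_upwards [hk.ae_memLp] with x hx
    rw [← hsq, ← mul_pow]
    gcongr
    exact enorm_integral_mul_le hx.1 (Lp.aestronglyMeasurable f)
  have hle : (eLpNorm (fun x => ∫ y, k x y * f y ∂volPos) 2 volPos) ^ 2 ≤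
      (eLpNorm (Function.uncurry k) 2 (volPos.prod volPos) * eLpNorm f 2 volPos) ^ 2 := by
    have hkm : AEMeasurable (fun p : ℝ × ℝ => ‖Function.uncurry k p‖ₑ ^ 2)
        (volPos.prod volPos) := hk.1.enorm.pow_const 2
    have hk2 : (eLpNorm (Function.uncurry k) 2 (volPos.prod volPos)) ^ 2 =
        ∫⁻ x, ∫⁻ y, ‖k x y‖ₑ ^ 2 ∂volPos ∂volPos := by
      rw [hsq, lintegral_prod _ hkm]
      rfl
    have hout : AEMeasurable (fun x => ∫⁻ y, ‖k x y‖ₑ ^ 2 ∂volPos) volPos :=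
      hkm.lintegral_prod_right'
    rw [mul_pow, hk2, hsq, ← lintegral_mul_const'' _ hout]
    exact lintegral_mono_ae hpt
  have hle' := (ENNReal.pow_le_pow_left_iff (two_ne_zero)).1 hle
  exact ⟨⟨hmeas, hle'.trans_lt (ENNReal.mul_lt_top hk.2 (Lp.memLp f).2)⟩, hle'⟩

theorem IsHSKernel.ae_integrable {k : ℝ → ℝ → ℝ} (hk : IsHSKernel k) (f : L2Pos) :
    ∀ᵐ x ∂volPos, Integrable (fun y => k x y * f y) volPos := by
  filter_upwards [hk.ae_memLp] with x hx
  exact hx.integrable_mul (Lp.memLp f)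

/-- The bounded operator `(T f)(x) = ∫_{ℝ₊} k(x, y) f(y) dy` on `L²(ℝ₊)`, for a Hilbert-Schmidt
kernel `k`. -/
def hsOp (k : ℝ → ℝ → ℝ) (hk : IsHSKernel k) : L2Pos →L[ℝ] L2Pos :=
  LinearMap.mkContinuous
    { toFun := fun f => (hk.memLp_apply f).1.toLp
      map_add' := by
        intro f g
        rw [← MemLp.toLp_add]
        apply MemLp.toLp_congr
        filter_upwards [hk.ae_integrable f, hk.ae_integrable g] with x hf hg
        rw [Pi.add_apply, ← integral_add hf hg]
        apply integral_congr_ae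
        filter_upwards [Lp.coeFn_add f g] with y hy
        rw [hy, Pi.add_apply, mul_add]
      map_smul' := by
        intro c f
        rw [RingHom.id_apply, ← MemLp.toLp_const_smul]
        apply MemLp.toLp_congr
        filter_upwards with x
        rw [Pi.smul_apply, smul_eq_mul, ← integral_const_mul]
        apply integral_congr_ae
        filter_upwards [Lp.coeFn_smul c f] with y hy
        rw [hy, Pi.smul_apply, smul_eq_mul]
        ring }
    (eLpNorm (Function.uncurry k) 2 (volPos.prod volPos)).toReal
    (by
      intro f
      change ‖(hk.memLp_apply f).1.toLp‖ ≤ _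
      rw [Lp.norm_toLp, Lp.norm_def, ← ENNReal.toReal_mul]
      exact ENNReal.toReal_mono (ENNReal.mul_ne_top hk.2.ne (Lp.memLp f).2.ne)
        (hk.memLp_apply f).2)

theorem hsOp_apply_ae (k : ℝ → ℝ → ℝ) (hk : IsHSKernel k) (f : L2Pos) :
    ∀ᵐ x ∂volPos, hsOp k hk f x = ∫ y, k x y * f y ∂volPos :=
  (hk.memLp_apply f).1.coeFn_toLp

open Classical in
/-- The operator on `L²(ℝ₊)` with kernel `k` (and `0` if `k` is not a Hilbert-Schmidt kernel). -/
def kernelOp (k : ℝ → ℝ → ℝ) : L2Pos →L[ℝ] L2Pos :=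
  if hk : IsHSKernel k then hsOp k hk else 0

/-- The kernel `𝐀(v₁, v₂) = A(v₁ + v₂)` attached to a function `A`. -/
def sumKernel (A : ℝ → ℝ) (v₁ v₂ : ℝ) : ℝ := A (v₁ + v₂)

/-- The kernel `(A ⊗ B)(v₁, v₂) = A(v₁) B(v₂)`. -/
def tensorKernel (A B : ℝ → ℝ) (v₁ v₂ : ℝ) : ℝ := A v₁ * B v₂

/-- `A⁽ᵏ⁾(v) = (-1)ᵏ dᵏA/dvᵏ`. -/
def signedDeriv (k : ℕ) (A : ℝ → ℝ) (v : ℝ) : ℝ := (-1) ^ k * iteratedDeriv k A v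

/-! ## Traces -/

/-- The diagonal sums `∑ᵢ ⟪bᵢ, T bᵢ⟫` converge absolutely, with the same value `a`, for every
orthonormal basis `b` of `L²(ℝ₊)`: the trace of `T` exists and is `a`. -/
def HasTrace (T : L2Pos →L[ℝ] L2Pos) (a : ℝ) : Prop :=
  ∀ (ι : Type) (b : HilbertBasis ι ℝ L2Pos), HasSum (fun i => inner ℝ (b i) (T (b i))) a

open Classical in
/-- The trace of an operator on `L²(ℝ₊)` (and `0` if there is none). -/
def opTrace (T : L2Pos →L[ℝ] L2Pos) : ℝ :=
  if h : ∃ a, HasTrace T a then h.choose else 0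

theorem HasTrace.opTrace_eq {T : L2Pos →L[ℝ] L2Pos} {a : ℝ} (h : HasTrace T a) :
    opTrace T = a := by
  have h' : ∃ a, HasTrace T a := ⟨a, h⟩
  obtain ⟨w, b, -⟩ := exists_hilbertBasis ℝ L2Pos
  rw [opTrace, dif_pos h']
  exact (h'.choose_spec w b).unique (h w b)

/-! ## Fredholm determinants and the Tracy-Widom distribution -/

/-- The function `(x₁, …, xₙ) ↦ det (k(xᵢ, xⱼ))`. -/
def fredholmMinor (k : ℝ → ℝ → ℝ) (n : ℕ) (x : Fin n → ℝ) : ℝ :=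
  Matrix.det (Matrix.of fun i j : Fin n => k (x i) (x j))

/-- The `n`-th term `((-1)ⁿ / n!) ∫_{ℝ₊ⁿ} det (k(xᵢ, xⱼ)) dⁿx` of the Fredholm series. -/
def fredholmTerm (k : ℝ → ℝ → ℝ) (n : ℕ) : ℝ :=
  (-1) ^ n / (n.factorial : ℝ) *
    ∫ x : Fin n → ℝ, fredholmMinor k n x ∂(Measure.pi fun _ => volPos)

/-- The integrals and the series that define the Fredholm determinant converge absolutely. -/
def FredholmConverges (k : ℝ → ℝ → ℝ) : Prop :=
  (∀ n : ℕ, Integrable (fredholmMinor k n) (Measure.pi fun _ => volPos)) ∧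
    Summable (fredholmTerm k)

/-- The Fredholm determinant `det (I - K)` on `L²(ℝ₊)` of the operator with (continuous)
kernel `k`. -/
def fredholmDet (k : ℝ → ℝ → ℝ) : ℝ := ∑' n : ℕ, fredholmTerm k n

/-- The Airy kernel `K_Ai(x, y) = ∫₀^∞ Ai(x + s) Ai(y + s) ds`. -/
def airyKernel (x y : ℝ) : ℝ := ∫ s in Ioi (0 : ℝ), airyAi (x + s) * airyAi (y + s)

/-- The shifted Airy kernel `K_{Ai, ξ}(v₁, v₂) = K_Ai(ξ + v₁, ξ + v₂)`. -/
def shiftedAiryKernel (ξ v₁ v₂ : ℝ) : ℝ := airyKernel (ξ + v₁) (ξ + v₂)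

/-- The GUE Tracy-Widom distribution function `F₂(ξ) = det (I - K_{Ai, ξ})` on `L²(ℝ₊)`. -/
def F2 (ξ : ℝ) : ℝ := fredholmDet (shiftedAiryKernel ξ)

/-! ## The quantities `a₀` and `a₁` -/

/-- `A₊(v) = Ai(ξ + η² + v) exp((ξ + v) η + 2 η³ / 3)`. -/
def APlus (ξ η v : ℝ) : ℝ :=
  airyAi (ξ + η ^ 2 + v) * Real.exp ((ξ + v) * η + 2 * η ^ 3 / 3)

/-- `A₋(v) = Ai(ξ + η² + v) exp(-(ξ + v) η - 2 η³ / 3)`. -/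
def AMinus (ξ η v : ℝ) : ℝ :=
  airyAi (ξ + η ^ 2 + v) * Real.exp (-(ξ + v) * η - 2 * η ^ 3 / 3)

/-- The operator `𝐊 = 𝐀₊ 𝐀₋` on `L²(ℝ₊)`. -/
def KOp (ξ η : ℝ) : L2Pos →L[ℝ] L2Pos :=
  kernelOp (sumKernel (APlus ξ η)) ∘L kernelOp (sumKernel (AMinus ξ η))

/-- `𝐈 - 𝐊*`. -/
def oneSubKStar (ξ η : ℝ) : L2Pos →L[ℝ] L2Pos :=
  ContinuousLinearMap.id ℝ L2Pos - ContinuousLinearMap.adjoint (KOp ξ η)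

/-- The operator `(𝐈 - 𝐊*)⁻¹ A₋ ⊗ A₊`, whose trace is `a₀(ξ, η)`. -/
def a0Op (ξ η : ℝ) : L2Pos →L[ℝ] L2Pos :=
  Ring.inverse (oneSubKStar ξ η) ∘L kernelOp (tensorKernel (AMinus ξ η) (APlus ξ η))

/-- The operator `(𝐈 - 𝐊*)⁻¹ A₋⁽¹⁾ ⊗ A₊`, whose trace is `a₁(ξ, η)`. -/
def a1Op (ξ η : ℝ) : L2Pos →L[ℝ] L2Pos :=
  Ring.inverse (oneSubKStar ξ η) ∘L
    kernelOp (tensorKernel (signedDeriv 1 (AMinus ξ η)) (APlus ξ η))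

/-- `a₀(ξ, η) = tr (𝐈 - 𝐊*)⁻¹ A₋ ⊗ A₊`. -/
def a0 (ξ η : ℝ) : ℝ := opTrace (a0Op ξ η)

/-- `a₁(ξ, η) = tr (𝐈 - 𝐊*)⁻¹ A₋⁽¹⁾ ⊗ A₊`. -/
def a1 (ξ η : ℝ) : ℝ := opTrace (a1Op ξ η)

end

noncomputable section

/-! ## The Airy function as a Laplace-type integral -/

/-! Write `A = Ai(ξ + ·)`, `K` for the operator with kernel `K_{Ai,ξ}`, `R = (1 - K)⁻¹` and `q = ⟪A,
R A⟫`. Since `K_{Ai,ξ}(x,y) = ∫_ξ^∞ Ai(s+x) Ai(s+y) ds`, the derivative of `K` in `ξ` has rank one: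
it is `-A ⊗ A`. The log-derivative of the determinant is therefore `F₂'/F₂ = q` (`hasDerivAt_F2`).
From `R' = -R (A ⊗ A) R` follows `q' = 2⟪A', R A⟫ - q²` (`hasDerivAt_airyLogDeriv`), so that `F₂'' =
F₂ (q' + q²) = 2 F₂ ⟪A', R A⟫`. As `tr R (B ⊗ A) = ⟪A, R B⟫` by Parseval, `a₁(ξ, 0) = -⟪A', R A⟫`,
which is the second formula. For the first, the factors `exp (± η v)` are removed by conjugation
with multiplication by `exp (-η v)`, which is bounded for `η ≥ 0`; this turns `a₀(ξ, η)` into `q(ξ +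
η²)` (`inner_resolvent_of_nonneg`). The case `η ≤ 0` follows by taking adjoints.

The determinant is differentiated as a series. The derivative of a minor is a sum of minors bordered
by `A`; after integration these satisfy Fredholm's recursion, whence their generating vector `u`
solves `(1 - K) u = det(1 - K) A` (`ExpData.one_sub_kernelOp_tsum_vec`). Hadamard's inequality gives
all the convergence needed.

Invertibility of `1 - K` rests on `K = S²`, where `S` has the kernel `Ai(ξ + x + y)`. `K` is a norm
limit of finite rank operators in effect, hence compact, so it suffices that `K f = f` forces `f =
0` (`eq_zero_of_airyOp_eq_self`). Such an `f` satisfies `‖S f‖ = ‖f‖`. But `S f` is a piece of the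
Airy transform `G(x) = ∫ Ai(x+s) f(s) ds`, a contraction into `L²(ℝ)` by Plancherel, so `G` vanishes
left of `ξ`; being the restriction of an entire function, it vanishes identically, and `f = S (S f)
= 0`. Positivity of `F₂` then follows from `F₂' = q F₂` with `q` continuous and `F₂ → 1` at `+∞`. -/

theorem exp_mul_abs_mul_gaussian_le (c : ℝ) {b : ℝ} (hb : 0 < b) (w : ℝ) :
    Real.exp (c * |w|) * Real.exp (-b * w ^ 2) ≤
      Real.exp (c ^ 2 / (2 * b)) * Real.exp (-(b / 2) * w ^ 2) := by
  rw [← Real.exp_add, ← Real.exp_add, Real.exp_le_exp]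
  have h : c ^ 2 / (2 * b) - c * |w| + b / 2 * |w| ^ 2 = (c - b * |w|) ^ 2 / (2 * b) := by
    field_simp
    ring
  have h2 : 0 ≤ (c - b * |w|) ^ 2 / (2 * b) := by positivity
  rw [sq_abs] at h
  linarith

/-- The point `a + 2 π i w` of the vertical line `Re z = a`. -/
def linePt (a w : ℝ) : ℂ := a + (2 * Real.pi * w : ℝ) * Complex.I

theorem continuous_linePt (a : ℝ) : Continuous (linePt a) := by
  unfold linePt
  fun_prop

theorem norm_linePt_le (a w : ℝ) : ‖linePt a w‖ ≤ |a| + 2 * Real.pi * |w| := by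
  refine (norm_add_le _ _).trans_eq ?_
  rw [norm_mul, Complex.norm_I, Complex.norm_real, Complex.norm_real, Real.norm_eq_abs,
    Real.norm_eq_abs, abs_mul, abs_of_pos (by positivity : (0 : ℝ) < 2 * Real.pi), mul_one]

theorem norm_linePt_le_exp (a w : ℝ) : ‖linePt a w‖ ≤ (|a| + 2 * Real.pi) * Real.exp |w| := by
  refine (norm_linePt_le a w).trans ?_
  have h1 : |w| + 1 ≤ Real.exp |w| := Real.add_one_le_exp _
  have h2 := abs_nonneg a
  have h3 := abs_nonneg w
  have h4 := Real.pi_pos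
  nlinarith [mul_le_mul_of_nonneg_left h1 (by positivity : 0 ≤ |a| + 2 * Real.pi)]

theorem norm_exp_neg_mul_linePt (a w x : ℝ) :
    ‖Complex.exp (-((x : ℂ) * linePt a w))‖ = Real.exp (-(a * x)) := by
  rw [Complex.norm_exp]
  congr 1
  simp [linePt]
  ring

/-- `G(z) = ∫ H(w) exp (-z (a + 2 π i w)) dw`. -/
def laplaceLine (H : ℝ → ℂ) (a : ℝ) (z : ℂ) : ℂ :=
  ∫ w : ℝ, H w * Complex.exp (-(z * linePt a w))

theorem integrable_gaussian_mul_const (C : ℝ) {b : ℝ} (hb : 0 < b) :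
    Integrable (fun w : ℝ => C * Real.exp (-b * w ^ 2)) :=
  (integrable_exp_neg_mul_sq hb).const_mul C

theorem norm_neg_linePt_mul_le {H : ℝ → ℂ} {a C b : ℝ} (hb : 0 < b)
    (hH : ∀ w, ‖H w‖ ≤ C * Real.exp (-b * w ^ 2)) (w : ℝ) :
    ‖-(linePt a w) * H w‖ ≤
      (|a| + 2 * Real.pi) * C * Real.exp (1 / (2 * b)) * Real.exp (-(b / 2) * w ^ 2) := by
  have hC : 0 ≤ C := by
    have := (norm_nonneg _).trans (hH 0)
    simpa using this
  have h1 := exp_mul_abs_mul_gaussian_le 1 hb w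
  rw [one_mul, one_pow] at h1
  rw [norm_mul, norm_neg]
  calc ‖linePt a w‖ * ‖H w‖
      ≤ ((|a| + 2 * Real.pi) * Real.exp |w|) * (C * Real.exp (-b * w ^ 2)) :=
        mul_le_mul (norm_linePt_le_exp a w) (hH w) (norm_nonneg _) (by positivity)
    _ = (|a| + 2 * Real.pi) * C * (Real.exp |w| * Real.exp (-b * w ^ 2)) := by ring
    _ ≤ (|a| + 2 * Real.pi) * C *
        (Real.exp (1 / (2 * b)) * Real.exp (-(b / 2) * w ^ 2)) := by gcongr
    _ = _ := by ring

/-- The exponential grows at most like `exp (2πR|w|)` on the line; completing the square absorbs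
this at the price of half the Gaussian exponent. Uniformity over the disc `‖z‖ ≤ R` is what
differentiation under the integral needs. -/
theorem norm_mul_exp_linePt_le {H : ℝ → ℂ} {a C b R : ℝ} (hb : 0 < b)
    (hH : ∀ w, ‖H w‖ ≤ C * Real.exp (-b * w ^ 2)) {z : ℂ} (hz : ‖z‖ ≤ R) (w : ℝ) :
    ‖H w * Complex.exp (-(z * linePt a w))‖ ≤
      C * Real.exp (R * |a|) * Real.exp ((R * (2 * Real.pi)) ^ 2 / (2 * b)) *
        Real.exp (-(b / 2) * w ^ 2) := by
  have hC : 0 ≤ C := by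
    have := (norm_nonneg _).trans (hH 0)
    simpa using this
  have h1 : ‖Complex.exp (-(z * linePt a w))‖ ≤
      Real.exp (R * |a|) * Real.exp (R * (2 * Real.pi) * |w|) := by
    rw [← Real.exp_add]
    refine (Complex.norm_exp_le_exp_norm _).trans (Real.exp_le_exp.2 ?_)
    rw [norm_neg, norm_mul]
    calc ‖z‖ * ‖linePt a w‖ ≤ R * (|a| + 2 * Real.pi * |w|) :=
          mul_le_mul hz (norm_linePt_le a w) (norm_nonneg _) ((norm_nonneg _).trans hz)
      _ = _ := by ring
  rw [norm_mul]
  calc ‖H w‖ * ‖Complex.exp (-(z * linePt a w))‖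
      ≤ (C * Real.exp (-b * w ^ 2)) *
        (Real.exp (R * |a|) * Real.exp (R * (2 * Real.pi) * |w|)) :=
        mul_le_mul (hH w) h1 (norm_nonneg _) (by positivity)
    _ = C * Real.exp (R * |a|) *
        (Real.exp (R * (2 * Real.pi) * |w|) * Real.exp (-b * w ^ 2)) := by ring
    _ ≤ C * Real.exp (R * |a|) *
        (Real.exp ((R * (2 * Real.pi)) ^ 2 / (2 * b)) * Real.exp (-(b / 2) * w ^ 2)) := by
        exact mul_le_mul_of_nonneg_left (exp_mul_abs_mul_gaussian_le _ hb w) (by positivity)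
    _ = _ := by ring

theorem integrable_mul_exp_linePt {H : ℝ → ℂ} {a C b : ℝ} (hb : 0 < b)
    (hHm : AEStronglyMeasurable H) (hH : ∀ w, ‖H w‖ ≤ C * Real.exp (-b * w ^ 2)) (z : ℂ) :
    Integrable (fun w => H w * Complex.exp (-(z * linePt a w))) := by
  have hc : Continuous fun w => Complex.exp (-(z * linePt a w)) := by
    have := continuous_linePt a
    fun_prop
  exact (integrable_gaussian_mul_const _ (half_pos hb)).mono'
    (hHm.mul hc.aestronglyMeasurable)
    (Filter.Eventually.of_forall (norm_mul_exp_linePt_le hb hH le_rfl))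

theorem hasDerivAt_laplaceLine {H : ℝ → ℂ} {a C b : ℝ} (hb : 0 < b)
    (hHm : AEStronglyMeasurable H) (hH : ∀ w, ‖H w‖ ≤ C * Real.exp (-b * w ^ 2)) (z : ℂ) :
    HasDerivAt (laplaceLine H a) (laplaceLine (fun w => -(linePt a w) * H w) a z) z := by
  have hc : ∀ z : ℂ, Continuous fun w => Complex.exp (-(z * linePt a w)) := by
    intro z
    have := continuous_linePt a
    fun_prop
  have hm : AEStronglyMeasurable fun w => -(linePt a w) * H w :=
    (continuous_linePt a).neg.aestronglyMeasurable.mul hHm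
  refine (hasDerivAt_integral_of_dominated_loc_of_deriv_le (μ := volume)
    (F := fun z w => H w * Complex.exp (-(z * linePt a w)))
    (F' := fun z w => -(linePt a w) * H w * Complex.exp (-(z * linePt a w)))
    -- Two successive losses: the factor `-(linePt a w)` lowers the Gaussian exponent from `b` to
    -- `b/2`, and the exponential, for `z'` within distance `1` of `z`, lowers it to `b/4`.
    (bound := fun w => (|a| + 2 * Real.pi) * C * Real.exp (1 / (2 * b)) *
      Real.exp ((‖z‖ + 1) * |a|) *
      Real.exp (((‖z‖ + 1) * (2 * Real.pi)) ^ 2 / (2 * (b / 2))) *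
        Real.exp (-(b / 2 / 2) * w ^ 2))
    (Metric.ball_mem_nhds z one_pos) ?_ ?_ ?_ ?_ ?_ ?_).2
  · exact Filter.Eventually.of_forall fun z => hHm.mul (hc z).aestronglyMeasurable
  · exact integrable_mul_exp_linePt hb hHm hH z
  · exact hm.mul (hc z).aestronglyMeasurable
  · refine Filter.Eventually.of_forall fun w z' hz' => ?_
    refine norm_mul_exp_linePt_le (half_pos hb) (norm_neg_linePt_mul_le hb hH) ?_ w
    have h1 : ‖z' - z‖ < 1 := by simpa [dist_eq_norm] using hz'
    have h2 : ‖z'‖ ≤ ‖z‖ + ‖z' - z‖ := by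
      simpa using norm_add_le z (z' - z)
    linarith
  · exact integrable_gaussian_mul_const _ (by positivity)
  · refine Filter.Eventually.of_forall fun w z' _ => ?_
    have h1 : HasDerivAt (fun z : ℂ => -(z * linePt a w)) (-(1 * linePt a w)) z' :=
      ((hasDerivAt_id z').mul_const _).neg
    exact (h1.cexp.const_mul (H w)).congr_deriv (by ring)

theorem norm_laplaceLine_ofReal_le (H : ℝ → ℂ) (a x : ℝ) :
    ‖laplaceLine H a x‖ ≤ (∫ w, ‖H w‖) * Real.exp (-(a * x)) := by
  refine (norm_integral_le_integral_norm _).trans_eq ?_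
  simp_rw [norm_mul, norm_exp_neg_mul_linePt]
  rw [integral_mul_const]

/-- The weight `exp (z ^ 3 / 3)` on the line `Re z = a`. -/
def airyWeight (a w : ℝ) : ℂ := Complex.exp (linePt a w ^ 3 / 3)

theorem continuous_airyWeight (a : ℝ) : Continuous (airyWeight a) := by
  have := continuous_linePt a
  unfold airyWeight
  fun_prop

theorem norm_airyWeight (a w : ℝ) :
    ‖airyWeight a w‖ = Real.exp (a ^ 3 / 3) * Real.exp (-(a * (2 * Real.pi) ^ 2) * w ^ 2) := by
  have h : linePt a w ^ 3 / 3 = ((a ^ 3 / 3 - a * (2 * Real.pi * w) ^ 2 : ℝ) : ℂ) +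
      ((a ^ 2 * (2 * Real.pi * w) - (2 * Real.pi * w) ^ 3 / 3 : ℝ) : ℂ) * Complex.I := by
    have hI : Complex.I ^ 3 = -Complex.I := by
      rw [pow_succ, Complex.I_sq]
      ring
    unfold linePt
    push_cast
    ring_nf
    rw [hI, Complex.I_sq]
    ring
  rw [airyWeight, Complex.norm_exp, h, ← Real.exp_add]
  congr 1
  simp only [Complex.add_re, Complex.ofReal_re, Complex.re_ofReal_mul, Complex.I_re]
  ring

theorem norm_airyWeight_le {a : ℝ} (w : ℝ) :
    ‖airyWeight a w‖ ≤ Real.exp (a ^ 3 / 3) * Real.exp (-(a * (2 * Real.pi) ^ 2) * w ^ 2) :=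
  (norm_airyWeight a w).le

theorem airyGaussian_pos {a : ℝ} (ha : 0 < a) : 0 < a * (2 * Real.pi) ^ 2 := by positivity

/-- Substitute `t = 2πw`, which absorbs the prefactor `1/(2π)` and matches the normalization of the
Fourier transform used later. -/
theorem ofReal_airyAi_eq_laplaceLine_one (x : ℝ) :
    (airyAi x : ℂ) = laplaceLine (airyWeight 1) 1 x := by
  have h1 : ∀ w : ℝ, airyWeight 1 w * Complex.exp (-((x : ℂ) * linePt 1 w)) =
      airyIntegrand x (2 * Real.pi * w) := by
    intro w
    rw [airyWeight, ← Complex.exp_add, airyIntegrand, linePt]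
    push_cast
    ring_nf
  have h2 : ∫ t : ℝ, airyIntegrand x t = ((∫ t : ℝ, airyIntegrand x t).re : ℂ) :=
    (Complex.ext (by simp) (by simp [airyIntegral_im])).symm
  simp only [laplaceLine, h1]
  rw [Measure.integral_comp_mul_left (airyIntegrand x), h2, airyAi,
    abs_of_pos (by positivity), Complex.real_smul]
  push_cast
  ring

/-- The line of integration of the Airy integral can be moved within `Re z > 0`. -/
theorem laplaceLine_airyWeight_eq {a : ℝ} (ha : 0 < a) (x : ℝ) :
    laplaceLine (airyWeight a) a x = laplaceLine (airyWeight 1) 1 x := by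
  set E : ℝ → ℝ → ℂ := fun a w => Complex.exp (linePt a w ^ 3 / 3 - x * linePt a w) with hE
  have hEq : ∀ a w : ℝ, airyWeight a w * Complex.exp (-((x : ℂ) * linePt a w)) = E a w := by
    intro a w
    rw [airyWeight, ← Complex.exp_add, ← sub_eq_add_neg]
  have hcont : ∀ a, Continuous (E a) := by
    intro a
    have := continuous_linePt a
    fun_prop
  have hnorm : ∀ a w : ℝ, ‖E a w‖ = Real.exp (a ^ 3 / 3) *
      Real.exp (-(a * (2 * Real.pi) ^ 2) * w ^ 2) * Real.exp (-(a * x)) := by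
    intro a w
    rw [← hEq, norm_mul, norm_airyWeight, norm_exp_neg_mul_linePt]
  have hint : ∀ {a : ℝ}, 0 < a → Integrable (E a) := by
    intro a ha
    rw [show E a = fun w => _ from funext fun w => (hEq a w).symm]
    exact integrable_mul_exp_linePt (airyGaussian_pos ha)
      (continuous_airyWeight a).aestronglyMeasurable norm_airyWeight_le _
  -- Instead of Cauchy's theorem on rectangles: the integral over the line is differentiated in the
  -- abscissa `a`.
  have hderiv : ∀ {a : ℝ}, 0 < a → HasDerivAt (fun a => ∫ w, E a w) 0 a := by
    intro a ha
    have hb : 0 < a / 2 := half_pos ha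
    -- For `|a' - a| < a/2` one has `a/2 ≤ a' ≤ 2a`, and `(2π)² ≥ 1` weakens the Gaussian to `exp
    -- (-(a/2) w²)`. Half of it pays for the `exp (2|w|)` that bounds the quadratic factor.
    set B : ℝ → ℝ := fun w => ((2 * a + 2 * Real.pi) ^ 2 + |x|) *
      (Real.exp ((2 * a) ^ 3 / 3) * Real.exp (2 * a * |x|)) *
      Real.exp (2 ^ 2 / (2 * (a / 2))) * Real.exp (-(a / 2 / 2) * w ^ 2)
    have hbound : ∀ w, ∀ a' ∈ Metric.ball a (a / 2),
        ‖(linePt a' w ^ 2 - x) * E a' w‖ ≤ B w := by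
      intro w a' ha'
      rw [Metric.mem_ball, Real.dist_eq, abs_lt] at ha'
      have ha1 : a / 2 ≤ a' := by linarith
      have ha2 : a' ≤ 2 * a := by linarith
      have ha0 : 0 < a' := by linarith
      have e1 : 1 ≤ Real.exp |w| := Real.one_le_exp (abs_nonneg _)
      have h1 : ‖linePt a' w ^ 2 - x‖ ≤
          ((2 * a + 2 * Real.pi) ^ 2 + |x|) * Real.exp (2 * |w|) := by
        have h2 : ‖linePt a' w‖ ≤ (2 * a + 2 * Real.pi) * Real.exp |w| := by
          refine (norm_linePt_le_exp a' w).trans ?_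
          rw [abs_of_pos ha0]
          gcongr
        have h3 : Real.exp (2 * |w|) = Real.exp |w| ^ 2 := by
          rw [← Real.exp_nat_mul]
          norm_num
        refine (norm_sub_le _ _).trans ?_
        rw [norm_pow, Complex.norm_real, Real.norm_eq_abs, h3, add_mul, ← mul_pow]
        gcongr
        nlinarith [abs_nonneg x, one_le_pow₀ e1 (n := 2)]
      have h4 : ‖E a' w‖ ≤ (Real.exp ((2 * a) ^ 3 / 3) * Real.exp (2 * a * |x|)) *
          Real.exp (-(a / 2) * w ^ 2) := by
        rw [hnorm]
        have h5 : Real.exp (a' ^ 3 / 3) ≤ Real.exp ((2 * a) ^ 3 / 3) := by gcongr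
        have h6 : Real.exp (-(a' * x)) ≤ Real.exp (2 * a * |x|) := by
          rw [Real.exp_le_exp]
          nlinarith [neg_abs_le x, abs_nonneg x]
        have h7 : Real.exp (-(a' * (2 * Real.pi) ^ 2) * w ^ 2) ≤
            Real.exp (-(a / 2) * w ^ 2) := by
          rw [Real.exp_le_exp]
          have h8 : 1 ≤ (2 * Real.pi) ^ 2 := one_le_pow₀ (by linarith [Real.pi_gt_three])
          have h9 : a / 2 ≤ a' * (2 * Real.pi) ^ 2 := by nlinarith
          nlinarith [sq_nonneg w]
        calc _ ≤ Real.exp ((2 * a) ^ 3 / 3) * Real.exp (-(a / 2) * w ^ 2) *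
              Real.exp (2 * a * |x|) := by gcongr
          _ = _ := by ring
      rw [norm_mul]
      calc _ ≤ (((2 * a + 2 * Real.pi) ^ 2 + |x|) * Real.exp (2 * |w|)) *
            ((Real.exp ((2 * a) ^ 3 / 3) * Real.exp (2 * a * |x|)) *
              Real.exp (-(a / 2) * w ^ 2)) :=
            mul_le_mul h1 h4 (norm_nonneg _) (by positivity)
        _ = ((2 * a + 2 * Real.pi) ^ 2 + |x|) *
            (Real.exp ((2 * a) ^ 3 / 3) * Real.exp (2 * a * |x|)) *
            (Real.exp (2 * |w|) * Real.exp (-(a / 2) * w ^ 2)) := by ring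
        _ ≤ ((2 * a + 2 * Real.pi) ^ 2 + |x|) *
            (Real.exp ((2 * a) ^ 3 / 3) * Real.exp (2 * a * |x|)) *
            (Real.exp (2 ^ 2 / (2 * (a / 2))) * Real.exp (-(a / 2 / 2) * w ^ 2)) := by
            exact mul_le_mul_of_nonneg_left (exp_mul_abs_mul_gaussian_le 2 hb w) (by positivity)
        _ = B w := by ring
    have hBint : Integrable B := integrable_gaussian_mul_const _ (half_pos hb)
    have hm : AEStronglyMeasurable fun w => (linePt a w ^ 2 - x) * E a w := by
      have := continuous_linePt a
      have := hcont a
      exact Continuous.aestronglyMeasurable (by fun_prop)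
    have hD := (hasDerivAt_integral_of_dominated_loc_of_deriv_le (μ := volume)
      (F := E) (F' := fun a w => (linePt a w ^ 2 - x) * E a w) (bound := B)
      (Metric.ball_mem_nhds a hb)
      (Filter.Eventually.of_forall fun a => (hcont a).aestronglyMeasurable)
      (hint ha) hm (Filter.Eventually.of_forall hbound) hBint
      (Filter.Eventually.of_forall fun w a' _ => by
        have h1 : HasDerivAt (fun a : ℝ => linePt a w) 1 a' :=
          (hasDerivAt_id a').ofReal_comp.add_const _
        exact (((h1.pow 3).div_const 3).sub (h1.const_mul (x : ℂ))).cexp.congr_deriv (by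
          simp only [hE, Pi.sub_apply, Pi.pow_apply]
          ring))).2
    have hDint : Integrable fun w => (linePt a w ^ 2 - x) * E a w :=
      hBint.mono' hm (Filter.Eventually.of_forall fun w =>
        hbound w a (Metric.mem_ball_self hb))
    -- By holomorphy `∂E/∂w = 2πi ∂E/∂a`, so the `a`-derivative is, up to a constant, the total
    -- derivative of an integrable function of `w`.
    have hzero : ∫ w, (2 * Real.pi * Complex.I) * ((linePt a w ^ 2 - x) * E a w) = 0 := by
      refine integral_eq_zero_of_hasDerivAt_of_integrable (f := E a) (fun w => ?_)
        (hDint.const_mul _) (hint ha)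
      have h1 : HasDerivAt (fun w : ℝ => linePt a w) (2 * Real.pi * Complex.I) w := by
        have h2 : HasDerivAt (fun w : ℝ => 2 * Real.pi * w) (2 * Real.pi) w := by
          simpa using (hasDerivAt_id w).const_mul (2 * Real.pi)
        simpa [linePt] using (h2.ofReal_comp.mul_const Complex.I).const_add (a : ℂ)
      exact (((h1.pow 3).div_const 3).sub (h1.const_mul (x : ℂ))).cexp.congr_deriv (by
          simp only [hE, Pi.sub_apply, Pi.pow_apply]
          ring)
    rw [integral_const_mul, mul_eq_zero] at hzero
    have h0 : ∫ w, (linePt a w ^ 2 - x) * E a w = 0 :=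
      hzero.resolve_left (by simp [Real.pi_ne_zero, Complex.I_ne_zero])
    rwa [h0] at hD
  have hconst := isOpen_Ioi.is_const_of_deriv_eq_zero (𝕜 := ℝ) (s := Ioi (0 : ℝ))
    (f := fun a => ∫ w, E a w) isPreconnected_Ioi
    (fun a ha => (hderiv ha).differentiableAt.differentiableWithinAt)
    (fun a ha => (hderiv ha).deriv) (mem_Ioi.2 ha) (mem_Ioi.2 one_pos)
  simpa only [laplaceLine, hEq] using hconst

theorem ofReal_airyAi_eq_laplaceLine {a : ℝ} (ha : 0 < a) (x : ℝ) :
    (airyAi x : ℂ) = laplaceLine (airyWeight a) a x := by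
  rw [laplaceLine_airyWeight_eq ha, ofReal_airyAi_eq_laplaceLine_one]

/-- The Airy function decays faster than every exponential. -/
theorem exists_abs_airyAi_le {a : ℝ} (ha : 0 < a) :
    ∃ C, 0 < C ∧ ∀ x, |airyAi x| ≤ C * Real.exp (-(a * x)) := by
  refine ⟨(∫ w, ‖airyWeight a w‖) + 1,
    add_pos_of_nonneg_of_pos (integral_nonneg fun _ => norm_nonneg _) one_pos, fun x => ?_⟩
  have h := norm_laplaceLine_ofReal_le (airyWeight a) a x
  rw [← ofReal_airyAi_eq_laplaceLine ha, Complex.norm_real, Real.norm_eq_abs] at h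
  refine h.trans ?_
  gcongr
  linarith

/-- The first two derivatives of the Airy function exist and decay exponentially. -/
theorem exists_airyAi_derivs : ∃ (A₁ A₂ : ℝ → ℝ) (C : ℝ), 0 < C ∧
    (∀ x, HasDerivAt airyAi (A₁ x) x) ∧ (∀ x, HasDerivAt A₁ (A₂ x) x) ∧
    (∀ x, |airyAi x| ≤ C * Real.exp (-x)) ∧ (∀ x, |A₁ x| ≤ C * Real.exp (-x)) ∧
    (∀ x, |A₂ x| ≤ C * Real.exp (-x)) := by
  set H₀ := airyWeight 1
  set H₁ : ℝ → ℂ := fun w => -(linePt 1 w) * H₀ w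
  set H₂ : ℝ → ℂ := fun w => -(linePt 1 w) * H₁ w
  have hb := airyGaussian_pos one_pos
  have hm0 : AEStronglyMeasurable H₀ := (continuous_airyWeight 1).aestronglyMeasurable
  have hm1 : AEStronglyMeasurable H₁ := (continuous_linePt 1).neg.aestronglyMeasurable.mul hm0
  have h0 := norm_airyWeight_le (a := 1)
  have h1 := norm_neg_linePt_mul_le (a := 1) hb h0
  have hA : airyAi = fun x : ℝ => (laplaceLine H₀ 1 x).re := by
    ext x
    rw [← ofReal_airyAi_eq_laplaceLine_one, Complex.ofReal_re]
  set I := fun H : ℝ → ℂ => ∫ w, ‖H w‖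
  have hI : ∀ H, 0 ≤ I H := fun H => integral_nonneg fun _ => norm_nonneg _
  have key : ∀ H : ℝ → ℂ, I H ≤ I H₀ + I H₁ + I H₂ + 1 → ∀ x : ℝ,
      |(laplaceLine H 1 x).re| ≤ (I H₀ + I H₁ + I H₂ + 1) * Real.exp (-x) := by
    intro H hH x
    refine (Complex.abs_re_le_norm _).trans ((norm_laplaceLine_ofReal_le H 1 x).trans ?_)
    rw [one_mul]
    gcongr
  refine ⟨fun x => (laplaceLine H₁ 1 x).re, fun x => (laplaceLine H₂ 1 x).re,
    I H₀ + I H₁ + I H₂ + 1, by linarith [hI H₀, hI H₁, hI H₂], fun x => ?_, fun x => ?_, ?_,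
    key H₁ (by linarith [hI H₀, hI H₁, hI H₂]), key H₂ (by linarith [hI H₀, hI H₁, hI H₂])⟩
  · rw [hA]
    exact (hasDerivAt_laplaceLine hb hm0 h0 x).real_of_complex
  · exact (hasDerivAt_laplaceLine (half_pos hb) hm1 h1 x).real_of_complex
  · rw [hA]
    exact key H₀ (by linarith [hI H₀, hI H₁, hI H₂])

/-! ## Kernels and functions with exponential decay -/

theorem toReal_eLpNorm_two_le {α : Type*} [MeasurableSpace α] {μ : Measure α} {f g : α → ℝ}
    {C : ℝ} (hC : 0 ≤ C) (hf : AEStronglyMeasurable f μ) (hg : Integrable g μ)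
    (hfg : ∀ᵐ x ∂μ, f x ^ 2 ≤ g x) (hgC : ∫ x, g x ∂μ ≤ C ^ 2) :
    MemLp f 2 μ ∧ (eLpNorm f 2 μ).toReal ≤ C := by
  have hi : Integrable (fun x => f x ^ 2) μ := by
    refine hg.mono' (hf.pow 2) ?_
    filter_upwards [hfg] with x hx
    rwa [Real.norm_eq_abs, abs_of_nonneg (sq_nonneg _)]
  have hm : MemLp f 2 μ := (memLp_two_iff_integrable_sq hf).2 hi
  refine ⟨hm, ?_⟩
  have h1 : (eLpNorm f 2 μ).toReal ^ 2 = ∫ x, f x ^ 2 ∂μ := by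
    rw [← Lp.norm_toLp f hm, ← real_inner_self_eq_norm_sq, L2.inner_def]
    refine integral_congr_ae ?_
    filter_upwards [hm.coeFn_toLp] with x hx
    rw [hx]
    simp [sq]
  refine abs_le_of_sq_le_sq' ?_ hC |>.2
  rw [h1]
  exact (integral_mono_ae hi hg hfg).trans hgC

theorem integrable_exp_neg_mul_pos {c : ℝ} (hc : 0 < c) :
    Integrable (fun x : ℝ => Real.exp (-(c * x))) volPos := by
  simpa [IntegrableOn] using exp_neg_integrableOn_Ioi 0 hc

theorem integral_exp_neg_mul_pos {c : ℝ} (hc : 0 < c) :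
    ∫ x, Real.exp (-(c * x)) ∂volPos = 1 / c := by
  have := integral_exp_mul_Ioi (neg_neg_of_pos hc) 0
  simpa [neg_mul, neg_div_neg_eq] using this

theorem ae_volPos_pos : ∀ᵐ x ∂volPos, 0 < x := ae_restrict_mem measurableSet_Ioi

theorem ae_prod_volPos_pos : ∀ᵐ p ∂(volPos.prod volPos), 0 < p.1 ∧ 0 < p.2 := by
  rw [Measure.prod_restrict]
  exact ae_restrict_mem (measurableSet_Ioi.prod measurableSet_Ioi)

theorem exp_neg_sq (x : ℝ) : Real.exp (-x) ^ 2 = Real.exp (-(2 * x)) := by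
  rw [← Real.exp_nat_mul]
  norm_num

/-- `f` is measurable and `|f x| ≤ C exp (-x)` on `ℝ₊`. -/
structure ExpBound (C : ℝ) (f : ℝ → ℝ) : Prop where
  measurable : Measurable f
  abs_le : ∀ x, 0 < x → |f x| ≤ C * Real.exp (-x)

/-- `k` is measurable and `|k x y| ≤ C exp (-x - y)` on `ℝ₊ × ℝ₊`. -/
structure ExpBound₂ (C : ℝ) (k : ℝ → ℝ → ℝ) : Prop where
  measurable : Measurable (Function.uncurry k)
  abs_le : ∀ x y, 0 < x → 0 < y → |k x y| ≤ C * Real.exp (-x) * Real.exp (-y)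

theorem ExpBound.nonneg {C : ℝ} {f : ℝ → ℝ} (hf : ExpBound C f) : 0 ≤ C := by
  have := (abs_nonneg _).trans (hf.abs_le 1 one_pos)
  exact nonneg_of_mul_nonneg_left this (Real.exp_pos _)

theorem ExpBound₂.nonneg {C : ℝ} {k : ℝ → ℝ → ℝ} (hk : ExpBound₂ C k) : 0 ≤ C := by
  have := (abs_nonneg _).trans (hk.abs_le 1 1 one_pos one_pos)
  rw [mul_assoc] at this
  exact nonneg_of_mul_nonneg_left this (by positivity)

theorem ExpBound.eLpNorm_le {C : ℝ} {f : ℝ → ℝ} (hf : ExpBound C f) :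
    MemLp f 2 volPos ∧ (eLpNorm f 2 volPos).toReal ≤ C := by
  refine toReal_eLpNorm_two_le hf.nonneg hf.measurable.aestronglyMeasurable
    ((integrable_exp_neg_mul_pos two_pos).const_mul (C ^ 2)) ?_ ?_
  · filter_upwards [ae_volPos_pos] with x hx
    rw [← exp_neg_sq, ← mul_pow, ← sq_abs]
    gcongr
    exact hf.abs_le x hx
  · rw [integral_const_mul, integral_exp_neg_mul_pos two_pos]
    nlinarith [sq_nonneg C]

theorem ExpBound.memLp {C : ℝ} {f : ℝ → ℝ} (hf : ExpBound C f) : MemLp f 2 volPos :=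
  hf.eLpNorm_le.1

theorem ExpBound.norm_toLp_le {C : ℝ} {f : ℝ → ℝ} (hf : ExpBound C f) :
    ‖hf.memLp.toLp f‖ ≤ C := by
  rw [Lp.norm_toLp]
  exact hf.eLpNorm_le.2

theorem ExpBound₂.eLpNorm_le {C : ℝ} {k : ℝ → ℝ → ℝ} (hk : ExpBound₂ C k) :
    IsHSKernel k ∧ (eLpNorm (Function.uncurry k) 2 (volPos.prod volPos)).toReal ≤ C := by
  have h2 := integrable_exp_neg_mul_pos two_pos
  refine toReal_eLpNorm_two_le hk.nonneg hk.measurable.aestronglyMeasurable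
    ((h2.mul_prod h2).const_mul (C ^ 2)) ?_ ?_
  · filter_upwards [ae_prod_volPos_pos] with p hp
    rw [← exp_neg_sq, ← exp_neg_sq, ← mul_pow, ← mul_pow, ← sq_abs, ← mul_assoc]
    gcongr
    exact hk.abs_le _ _ hp.1 hp.2
  · rw [integral_const_mul, integral_prod_mul (fun x => Real.exp (-(2 * x)))
      (fun x => Real.exp (-(2 * x))), integral_exp_neg_mul_pos two_pos]
    nlinarith [sq_nonneg C]

theorem ExpBound₂.isHSKernel {C : ℝ} {k : ℝ → ℝ → ℝ} (hk : ExpBound₂ C k) : IsHSKernel k :=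
  hk.eLpNorm_le.1

theorem kernelOp_apply_ae {k : ℝ → ℝ → ℝ} (hk : IsHSKernel k) (f : L2Pos) :
    ∀ᵐ x ∂volPos, kernelOp k f x = ∫ y, k x y * f y ∂volPos := by
  rw [kernelOp, dif_pos hk]
  exact hsOp_apply_ae k hk f

theorem ExpBound₂.norm_kernelOp_le {C : ℝ} {k : ℝ → ℝ → ℝ} (hk : ExpBound₂ C k) :
    ‖kernelOp k‖ ≤ C := by
  rw [kernelOp, dif_pos hk.isHSKernel]
  exact (LinearMap.mkContinuous_norm_le _ ENNReal.toReal_nonneg _).trans hk.eLpNorm_le.2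

theorem kernelOp_sub {k l : ℝ → ℝ → ℝ} (hk : IsHSKernel k) (hl : IsHSKernel l) :
    kernelOp (fun x y => k x y - l x y) = kernelOp k - kernelOp l := by
  have hkl : IsHSKernel (fun x y => k x y - l x y) := MemLp.sub hk hl
  ext1 f
  apply Lp.ext
  rw [sub_apply]
  filter_upwards [kernelOp_apply_ae hkl f, kernelOp_apply_ae hk f, kernelOp_apply_ae hl f,
    Lp.coeFn_sub (kernelOp k f) (kernelOp l f), hk.ae_integrable f, hl.ae_integrable f]
    with x h1 h2 h3 h4 h5 h6
  rw [h1, h4, Pi.sub_apply, h2, h3, ← integral_sub h5 h6]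
  simp_rw [sub_mul]

theorem kernelOp_const_mul (c : ℝ) {k : ℝ → ℝ → ℝ} (hk : IsHSKernel k) :
    kernelOp (fun x y => c * k x y) = c • kernelOp k := by
  have hck : IsHSKernel (fun x y => c * k x y) := MemLp.const_mul hk c
  ext1 f
  apply Lp.ext
  rw [smul_apply]
  filter_upwards [kernelOp_apply_ae hck f, kernelOp_apply_ae hk f,
    Lp.coeFn_smul c (kernelOp k f)] with x h1 h2 h3
  rw [h1, h3, Pi.smul_apply, h2, smul_eq_mul, ← integral_const_mul]
  simp_rw [mul_assoc]

/-! ### Inner products, adjoints and operators of rank one -/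

theorem inner_eq_integral (f g : L2Pos) : inner ℝ f g = ∫ x, f x * g x ∂volPos := by
  rw [L2.inner_def]
  simp [mul_comm]

theorem inner_toLp_eq_integral {u v : ℝ → ℝ} (hu : MemLp u 2 volPos) (hv : MemLp v 2 volPos) :
    inner ℝ (hu.toLp u) (hv.toLp v) = ∫ x, u x * v x ∂volPos := by
  rw [inner_eq_integral]
  refine integral_congr_ae ?_
  filter_upwards [hu.coeFn_toLp, hv.coeFn_toLp] with x h1 h2
  rw [h1, h2]

theorem memLp_two_mul_prod (f g : L2Pos) :
    MemLp (fun p : ℝ × ℝ => f p.1 * g p.2) 2 (volPos.prod volPos) := by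
  have hm : AEStronglyMeasurable (fun p : ℝ × ℝ => f p.1 * g p.2) (volPos.prod volPos) :=
    (Lp.aestronglyMeasurable f).comp_fst.mul (Lp.aestronglyMeasurable g).comp_snd
  rw [memLp_two_iff_integrable_sq hm]
  simp_rw [mul_pow]
  exact (Lp.memLp f).integrable_sq.mul_prod (Lp.memLp g).integrable_sq

theorem integrable_kernel_mul {k : ℝ → ℝ → ℝ} (hk : IsHSKernel k) (f g : L2Pos) :
    Integrable (fun p : ℝ × ℝ => k p.1 p.2 * (f p.1 * g p.2)) (volPos.prod volPos) :=
  MemLp.integrable_mul hk (memLp_two_mul_prod f g)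

theorem inner_kernelOp {k : ℝ → ℝ → ℝ} (hk : IsHSKernel k) (f g : L2Pos) :
    inner ℝ f (kernelOp k g) = ∫ x, ∫ y, k x y * (f x * g y) ∂volPos ∂volPos := by
  rw [inner_eq_integral]
  refine integral_congr_ae ?_
  filter_upwards [kernelOp_apply_ae hk g] with x hx
  rw [hx, ← integral_const_mul]
  congr 1
  ext y
  ring

theorem inner_kernelOp_comm {k : ℝ → ℝ → ℝ} (hk : IsHSKernel k) (hs : ∀ x y, k x y = k y x)
    (f g : L2Pos) : inner ℝ (kernelOp k f) g = inner ℝ f (kernelOp k g) := by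
  rw [real_inner_comm, inner_kernelOp hk, inner_kernelOp hk,
    integral_integral_swap (integrable_kernel_mul hk g f)]
  congr 1
  ext x
  congr 1
  ext y
  rw [hs, mul_comm (g y)]

theorem adjoint_kernelOp {k : ℝ → ℝ → ℝ} (hk : IsHSKernel k) (hs : ∀ x y, k x y = k y x) :
    ContinuousLinearMap.adjoint (kernelOp k) = kernelOp k :=
  ((ContinuousLinearMap.eq_adjoint_iff _ _).2 (inner_kernelOp_comm hk hs)).symm

theorem ExpBound.tensorKernel {C D : ℝ} {A B : ℝ → ℝ} (hA : ExpBound C A) (hB : ExpBound D B) :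
    ExpBound₂ (C * D) (tensorKernel A B) := by
  refine ⟨(hA.measurable.comp measurable_fst).mul (hB.measurable.comp measurable_snd),
    fun x y hx hy => ?_⟩
  rw [_root_.tensorKernel, abs_mul]
  calc |A x| * |B y| ≤ (C * Real.exp (-x)) * (D * Real.exp (-y)) :=
        mul_le_mul (hA.abs_le x hx) (hB.abs_le y hy) (abs_nonneg _)
          (mul_nonneg hA.nonneg (Real.exp_pos _).le)
    _ = _ := by ring

theorem kernelOp_tensorKernel {A B : ℝ → ℝ} (h : IsHSKernel (tensorKernel A B))
    (hA : MemLp A 2 volPos) (hB : MemLp B 2 volPos) (f : L2Pos) :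
    kernelOp (tensorKernel A B) f = (inner ℝ (hB.toLp B) f : ℝ) • hA.toLp A := by
  apply Lp.ext
  filter_upwards [kernelOp_apply_ae h f, hA.coeFn_toLp,
    Lp.coeFn_smul (inner ℝ (hB.toLp B) f : ℝ) (hA.toLp A)] with x h1 h2 h3
  rw [h1, h3, Pi.smul_apply, h2, smul_eq_mul, inner_eq_integral, mul_comm]
  simp_rw [tensorKernel, mul_assoc]
  rw [integral_const_mul]
  congr 1
  refine integral_congr_ae ?_
  filter_upwards [hB.coeFn_toLp] with y hy
  rw [hy]

/-- The diagonal entry at `bᵢ` is `⟪B, bᵢ⟫ ⟪bᵢ, R A⟫`, so the trace is Parseval's identity, in any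
orthonormal basis. -/
theorem hasTrace_comp_tensorKernel {A B : ℝ → ℝ} (h : IsHSKernel (tensorKernel A B))
    (hA : MemLp A 2 volPos) (hB : MemLp B 2 volPos) (R : L2Pos →L[ℝ] L2Pos) :
    HasTrace (R ∘L kernelOp (tensorKernel A B)) (inner ℝ (hB.toLp B) (R (hA.toLp A))) := by
  intro ι b
  have := b.hasSum_inner_mul_inner (hB.toLp B) (R (hA.toLp A))
  have e : (fun i => inner ℝ (b i) ((R ∘L kernelOp (tensorKernel A B)) (b i))) =
      fun i => inner ℝ (hB.toLp B) (b i) * inner ℝ (b i) (R (hA.toLp A)) := by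
    ext i
    rw [ContinuousLinearMap.comp_apply, kernelOp_tensorKernel h hA hB, map_smul, inner_smul_right]
  rwa [← e] at this

/-- The operator factors through the locally compact space `ℝ`. -/
theorem isCompactOperator_kernelOp_tensorKernel {A B : ℝ → ℝ} (h : IsHSKernel (tensorKernel A B))
    (hA : MemLp A 2 volPos) (hB : MemLp B 2 volPos) :
    IsCompactOperator (kernelOp (tensorKernel A B)) := by
  have h1 : (kernelOp (tensorKernel A B) : L2Pos → L2Pos) =
      (ContinuousLinearMap.toSpanSingleton ℝ (hA.toLp A)) ∘ (innerSL ℝ (hB.toLp B)) := by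
    ext1 f
    rw [kernelOp_tensorKernel h hA hB]
    simp
  rw [h1]
  exact (isCompactOperator_of_locallyCompactSpace_dom (innerSL ℝ (hB.toLp B))).clm_comp
    (ContinuousLinearMap.toSpanSingleton ℝ (hA.toLp A))

/-- The kernel of the product of two integral operators. -/
def compKernel (k l : ℝ → ℝ → ℝ) (x z : ℝ) : ℝ := ∫ y, k x y * l y z ∂volPos

theorem ExpBound₂.comp {C D : ℝ} {k l : ℝ → ℝ → ℝ} (hk : ExpBound₂ C k) (hl : ExpBound₂ D l) :
    ExpBound₂ (C * D) (compKernel k l) := by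
  constructor
  · have hm : Measurable fun q : (ℝ × ℝ) × ℝ => k q.1.1 q.2 * l q.2 q.1.2 :=
      (hk.measurable.comp (measurable_fst.fst.prodMk measurable_snd)).mul
        (hl.measurable.comp (measurable_snd.prodMk measurable_fst.snd))
    exact hm.stronglyMeasurable.integral_prod_right.measurable
  · intro x z hx hz
    have hC := hk.nonneg
    have hD := hl.nonneg
    have h1 : |compKernel k l x z| ≤
        ∫ y, C * D * Real.exp (-x) * Real.exp (-z) * Real.exp (-(2 * y)) ∂volPos := by
      rw [← Real.norm_eq_abs]
      refine norm_integral_le_of_norm_le ((integrable_exp_neg_mul_pos two_pos).const_mul _) ?_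
      filter_upwards [ae_volPos_pos] with y hy
      rw [norm_mul, ← exp_neg_sq]
      calc ‖k x y‖ * ‖l y z‖ ≤ (C * Real.exp (-x) * Real.exp (-y)) *
            (D * Real.exp (-y) * Real.exp (-z)) :=
            mul_le_mul (hk.abs_le x y hx hy) (hl.abs_le y z hy hz) (norm_nonneg _) (by positivity)
        _ = _ := by ring
    rw [integral_const_mul, integral_exp_neg_mul_pos two_pos] at h1
    have h2 : 0 ≤ C * D * Real.exp (-x) * Real.exp (-z) := by positivity
    linarith

/-- Fubini; the exponential bounds make the double integrand absolutely integrable for every fixed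
`x > 0`. -/
theorem kernelOp_comp {C D : ℝ} {k l : ℝ → ℝ → ℝ} (hk : ExpBound₂ C k) (hl : ExpBound₂ D l) :
    kernelOp k ∘L kernelOp l = kernelOp (compKernel k l) := by
  have hC := hk.nonneg
  have hD := hl.nonneg
  ext1 f
  apply Lp.ext
  rw [ContinuousLinearMap.comp_apply]
  have he : MemLp (fun x : ℝ => Real.exp (-x)) 2 volPos :=
    (ExpBound.memLp (C := 1) ⟨by fun_prop, fun x _ => by simp⟩)
  have hf : Integrable (fun z => Real.exp (-z) * |f z|) volPos :=
    he.integrable_mul (Lp.memLp f).abs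
  filter_upwards [kernelOp_apply_ae hk.isHSKernel (kernelOp l f),
    kernelOp_apply_ae (hk.comp hl).isHSKernel f, ae_volPos_pos] with x h1 h2 hx
  rw [h1, h2]
  have h3 : ∫ y, k x y * kernelOp l f y ∂volPos =
      ∫ y, ∫ z, k x y * l y z * f z ∂volPos ∂volPos := by
    refine integral_congr_ae ?_
    filter_upwards [kernelOp_apply_ae hl.isHSKernel f] with y hy
    rw [hy, ← integral_const_mul]
    simp_rw [mul_assoc]
  have hm : Measurable fun p : ℝ × ℝ => k x p.1 * l p.1 p.2 :=
    (hk.measurable.comp (measurable_const.prodMk measurable_fst)).mul hl.measurable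
  have hint : Integrable (Function.uncurry fun y z => k x y * l y z * f z)
      (volPos.prod volPos) := by
    refine (((integrable_exp_neg_mul_pos two_pos).mul_prod hf).const_mul
      (C * D * Real.exp (-x))).mono' (hm.aestronglyMeasurable.mul
        (Lp.aestronglyMeasurable f).comp_snd) ?_
    filter_upwards [ae_prod_volPos_pos] with p hp
    simp only [Function.uncurry]
    rw [norm_mul, norm_mul, ← exp_neg_sq, Real.norm_eq_abs (f p.2)]
    calc ‖k x p.1‖ * ‖l p.1 p.2‖ * |f p.2| ≤ ((C * Real.exp (-x) * Real.exp (-p.1)) *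
            (D * Real.exp (-p.1) * Real.exp (-p.2))) * |f p.2| := by
            gcongr
            · exact hk.abs_le _ _ hx hp.1
            · exact hl.abs_le _ _ hp.1 hp.2
      _ = _ := by ring
  rw [h3, integral_integral_swap hint]
  congr 1
  ext z
  rw [integral_mul_const, compKernel]

/-! ## Multiplication operators -/

theorem memLp_top_exp_neg {η : ℝ} (hη : 0 ≤ η) :
    MemLp (fun x : ℝ => Real.exp (-(η * x))) ⊤ volPos := by
  refine memLp_top_of_bound (by fun_prop) 1 ?_
  filter_upwards [ae_volPos_pos] with x hx
  rw [Real.norm_eq_abs, Real.abs_exp, Real.exp_le_one_iff]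
  have := mul_nonneg hη hx.le
  linarith

/-- Multiplication by `exp (-η x)` on `L²(ℝ₊)`, for `η ≥ 0`. -/
def mulExp (η : ℝ) (hη : 0 ≤ η) : L2Pos →L[ℝ] L2Pos :=
  (ContinuousLinearMap.mul ℝ ℝ).holderL volPos ⊤ 2 2 (memLp_top_exp_neg hη).toLp

theorem mulExp_apply_ae {η : ℝ} (hη : 0 ≤ η) (f : L2Pos) :
    ∀ᵐ x ∂volPos, mulExp η hη f x = Real.exp (-(η * x)) * f x := by
  filter_upwards [(ContinuousLinearMap.mul ℝ ℝ).coeFn_holder (r := 2)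
    (memLp_top_exp_neg hη).toLp f, (memLp_top_exp_neg hη).coeFn_toLp] with x h1 h2
  rw [← h2]
  exact h1

theorem inner_mulExp_comm {η : ℝ} (hη : 0 ≤ η) (f g : L2Pos) :
    inner ℝ (mulExp η hη f) g = inner ℝ f (mulExp η hη g) := by
  rw [inner_eq_integral, inner_eq_integral]
  refine integral_congr_ae ?_
  filter_upwards [mulExp_apply_ae hη f, mulExp_apply_ae hη g] with x h1 h2
  rw [h1, h2]
  ring

/-- Only this two-sided product is needed: the inverse of the multiplication is unbounded for `η >
0`, so a similarity transformation is not available. -/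
theorem mulExp_comp_kernelOp_comp_mulExp {η : ℝ} (hη : 0 ≤ η) {k l : ℝ → ℝ → ℝ}
    (hk : IsHSKernel k) (hl : IsHSKernel l)
    (hkl : ∀ x y, l x y = Real.exp (-(η * x)) * k x y * Real.exp (-(η * y))) :
    mulExp η hη * kernelOp k * mulExp η hη = kernelOp l := by
  ext1 f
  apply Lp.ext
  rw [mul_apply_eq_comp, mul_apply_eq_comp]
  filter_upwards [mulExp_apply_ae hη (kernelOp k (mulExp η hη f)),
    kernelOp_apply_ae hk (mulExp η hη f), kernelOp_apply_ae hl f] with x h1 h2 h3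
  rw [h1, h2, h3, ← integral_const_mul]
  refine integral_congr_ae ?_
  filter_upwards [mulExp_apply_ae hη f] with y hy
  rw [hy, hkl]
  ring

/-! ## The Airy kernel and its dependence on the shift -/

/-- Reduces differentiability in norm to a quadratic Taylor remainder, which for vectors and kernels
is checked pointwise. -/
theorem hasDerivAt_of_quadratic {E : Type*} [NormedAddCommGroup E] [NormedSpace ℝ E]
    {F : ℝ → E} {F' : E} {ξ D : ℝ}
    (h : ∀ t, |t| ≤ 1 → ‖F (ξ + t) - F ξ - t • F'‖ ≤ D * t ^ 2) : HasDerivAt F F' ξ := by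
  rw [hasDerivAt_iff_isLittleO_nhds_zero]
  have h1 : (fun t => F (ξ + t) - F ξ - t • F') =O[nhds 0] fun t : ℝ => t ^ 2 := by
    refine Asymptotics.IsBigO.of_bound D ?_
    filter_upwards [Metric.closedBall_mem_nhds (0 : ℝ) one_pos] with t ht
    rw [Real.norm_eq_abs, abs_of_nonneg (sq_nonneg t)]
    exact h t (by simpa using ht)
  refine h1.trans_isLittleO ?_
  simpa using Asymptotics.isLittleO_pow_pow (𝕜 := ℝ) (one_lt_two (α := ℕ))

/-- The mean value inequality applied twice, first to `g'` and then to `s ↦ g s - s * g' ξ`; the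
factor `1/2` of Taylor's formula is given up. -/
theorem abs_sub_sub_mul_deriv_le {g g' g'' : ℝ → ℝ} {ξ D : ℝ} (h1 : ∀ s, HasDerivAt g (g' s) s)
    (h2 : ∀ s, HasDerivAt g' (g'' s) s) (hD : ∀ s, |s - ξ| ≤ 1 → |g'' s| ≤ D) {t : ℝ}
    (ht : |t| ≤ 1) : |g (ξ + t) - g ξ - t * g' ξ| ≤ D * t ^ 2 := by
  have hc : Convex ℝ (uIcc ξ (ξ + t)) := convex_uIcc _ _
  have hs : ∀ s ∈ uIcc ξ (ξ + t), |s - ξ| ≤ |t| := by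
    intro s hs
    simpa [add_sub_cancel_left] using abs_sub_left_of_mem_uIcc hs
  have h3 : ∀ s ∈ uIcc ξ (ξ + t), ‖g' s - g' ξ‖ ≤ D * |t| := by
    intro s hs'
    have h := hc.norm_image_sub_le_of_norm_hasDerivWithin_le
      (fun s _ => (h2 s).hasDerivWithinAt) (fun s hs' => hD s ((hs s hs').trans ht))
      left_mem_uIcc hs'
    have hD0 : 0 ≤ D := (abs_nonneg _).trans (hD ξ (by simp))
    exact h.trans (mul_le_mul_of_nonneg_left (hs s hs') hD0)
  have h4 := hc.norm_image_sub_le_of_norm_hasDerivWithin_le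
    (f := fun s => g s - s * g' ξ) (f' := fun s => g' s - g' ξ)
    (fun s _ => (((h1 s).sub ((hasDerivAt_id s).mul_const (g' ξ))).congr_deriv
      (by simp)).hasDerivWithinAt) h3 left_mem_uIcc right_mem_uIcc
  have e1 : g (ξ + t) - (ξ + t) * g' ξ - (g ξ - ξ * g' ξ) = g (ξ + t) - g ξ - t * g' ξ := by ring
  rw [e1, add_sub_cancel_left, Real.norm_eq_abs, Real.norm_eq_abs, mul_assoc, ← sq, sq_abs] at h4
  exact h4

theorem hasDerivAt_airyAi (x : ℝ) : HasDerivAt airyAi (deriv airyAi x) x := by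
  obtain ⟨A₁, A₂, C, -, h, -⟩ := exists_airyAi_derivs
  exact (h x).differentiableAt.hasDerivAt

theorem hasDerivAt_deriv_airyAi (x : ℝ) :
    HasDerivAt (deriv airyAi) (deriv (deriv airyAi) x) x := by
  obtain ⟨A₁, A₂, C, -, h1, h2, -⟩ := exists_airyAi_derivs
  rw [show deriv airyAi = A₁ from funext fun x => (h1 x).deriv]
  exact (h2 x).differentiableAt.hasDerivAt

theorem exists_airyAi_bound : ∃ C, 0 < C ∧ (∀ x, |airyAi x| ≤ C * Real.exp (-x)) ∧
    (∀ x, |deriv airyAi x| ≤ C * Real.exp (-x)) ∧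
    (∀ x, |deriv (deriv airyAi) x| ≤ C * Real.exp (-x)) := by
  obtain ⟨A₁, A₂, C, hC, h1, h2, b0, b1, b2⟩ := exists_airyAi_derivs
  have e1 : deriv airyAi = A₁ := funext fun x => (h1 x).deriv
  have e2 : deriv A₁ = A₂ := funext fun x => (h2 x).deriv
  rw [e1, e2]
  exact ⟨C, hC, b0, b1, b2⟩

theorem continuous_airyAi : Continuous airyAi :=
  continuous_iff_continuousAt.2 fun x => (hasDerivAt_airyAi x).continuousAt

theorem continuous_deriv_airyAi : Continuous (deriv airyAi) :=
  continuous_iff_continuousAt.2 fun x => (hasDerivAt_deriv_airyAi x).continuousAt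

theorem expBound_shift {g : ℝ → ℝ} {C : ℝ} (hg : Measurable g)
    (h : ∀ x, |g x| ≤ C * Real.exp (-x)) (ξ : ℝ) :
    ExpBound (C * Real.exp (-ξ)) fun v => g (ξ + v) := by
  refine ⟨by fun_prop, fun x _ => (h _).trans_eq ?_⟩
  rw [neg_add, Real.exp_add, mul_assoc]

theorem memLp_airyAi_shift (ξ : ℝ) : MemLp (fun v => airyAi (ξ + v)) 2 volPos := by
  obtain ⟨C, -, h, -⟩ := exists_airyAi_bound
  exact (expBound_shift continuous_airyAi.measurable h ξ).memLp

theorem memLp_deriv_airyAi_shift (ξ : ℝ) :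
    MemLp (fun v => deriv airyAi (ξ + v)) 2 volPos := by
  obtain ⟨C, -, -, h, -⟩ := exists_airyAi_bound
  exact (expBound_shift continuous_deriv_airyAi.measurable h ξ).memLp

/-- The function `v ↦ Ai (ξ + v)` in `L²(ℝ₊)`. -/
def airyVec (ξ : ℝ) : L2Pos := (memLp_airyAi_shift ξ).toLp

/-- The function `v ↦ Ai' (ξ + v)` in `L²(ℝ₊)`. -/
def airyDerivVec (ξ : ℝ) : L2Pos := (memLp_deriv_airyAi_shift ξ).toLp

theorem exp_neg_add_le {s ξ v : ℝ} (hs : |s - ξ| ≤ 1) :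
    Real.exp (-(s + v)) ≤ Real.exp (1 - ξ) * Real.exp (-v) := by
  rw [← Real.exp_add, Real.exp_le_exp]
  linarith [(abs_le.1 hs).1]

/-- The pointwise Taylor remainder is at most a constant times `t² exp (-v)`, because the second
derivative of `Ai` decays exponentially; an `ExpBound` controls the `L²` norm. -/
theorem hasDerivAt_airyVec (ξ : ℝ) : HasDerivAt airyVec (airyDerivVec ξ) ξ := by
  obtain ⟨C, hC, -, -, h2⟩ := exists_airyAi_bound
  refine hasDerivAt_of_quadratic (D := C * Real.exp (1 - ξ)) fun t ht => ?_
  have hb : ExpBound (C * Real.exp (1 - ξ) * t ^ 2)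
      fun v => airyAi (ξ + t + v) - airyAi (ξ + v) - t * deriv airyAi (ξ + v) := by
    constructor
    · have h1 := continuous_airyAi
      have h2 := continuous_deriv_airyAi
      exact Continuous.measurable (by fun_prop)
    · intro v _
      have h := abs_sub_sub_mul_deriv_le (g := fun s => airyAi (s + v))
        (g' := fun s => deriv airyAi (s + v)) (g'' := fun s => deriv (deriv airyAi) (s + v))
        (ξ := ξ) (D := C * (Real.exp (1 - ξ) * Real.exp (-v)))
        (fun s => (hasDerivAt_airyAi _).comp_add_const s v)
        (fun s => (hasDerivAt_deriv_airyAi _).comp_add_const s v)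
        (fun s hs => (h2 _).trans (mul_le_mul_of_nonneg_left (exp_neg_add_le hs) hC.le)) ht
      exact h.trans_eq (by ring)
  have he : airyVec (ξ + t) - airyVec ξ - t • airyDerivVec ξ = hb.memLp.toLp := by
    rw [airyVec, airyVec, airyDerivVec, ← MemLp.toLp_const_smul, ← MemLp.toLp_sub,
      ← MemLp.toLp_sub]
    rfl
  rw [he]
  exact hb.norm_toLp_le

/-! ### The Airy kernel as a function of the shift -/

theorem integrableOn_airyAi_mul (x y : ℝ) :
    IntegrableOn (fun s => airyAi (x + s) * airyAi (y + s)) (Ioi 0) :=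
  (memLp_airyAi_shift x).integrable_mul (memLp_airyAi_shift y)

theorem integrableOn_Ioi_airyAi_mul (x y ξ : ℝ) :
    IntegrableOn (fun s => airyAi (s + x) * airyAi (s + y)) (Ioi ξ) := by
  have h := integrableOn_airyAi_mul (ξ + x) (ξ + y)
  have hp : (fun s : ℝ => ξ + s) ⁻¹' Ioi ξ = Ioi 0 := by
    ext s
    simp
  rw [← (measurePreserving_add_left volume ξ).integrableOn_comp_preimage
    (MeasurableEquiv.addLeft ξ).measurableEmbedding, hp]
  refine h.congr_fun (fun s _ => ?_) measurableSet_Ioi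
  simp only [Function.comp_apply]
  congr 2 <;> ring

/-- After this translation `ξ` occurs only as the limit of integration, so that the `ξ`-derivative
is given by the fundamental theorem of calculus. -/
theorem shiftedAiryKernel_eq_integral_Ioi (ξ x y : ℝ) :
    shiftedAiryKernel ξ x y = ∫ s in Ioi ξ, airyAi (s + x) * airyAi (s + y) := by
  have hp : (fun s : ℝ => ξ + s) ⁻¹' Ioi ξ = Ioi 0 := by
    ext s
    simp
  rw [shiftedAiryKernel, airyKernel, ← (measurePreserving_add_left volume ξ).setIntegral_preimage_emb
    (MeasurableEquiv.addLeft ξ).measurableEmbedding (fun s => airyAi (s + x) * airyAi (s + y)), hp]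
  refine setIntegral_congr_fun measurableSet_Ioi fun s _ => ?_
  congr 2 <;> ring

theorem hasDerivAt_shiftedAiryKernel (ξ x y : ℝ) :
    HasDerivAt (fun ξ => shiftedAiryKernel ξ x y) (-(airyAi (ξ + x) * airyAi (ξ + y))) ξ := by
  have hc : Continuous fun s => airyAi (s + x) * airyAi (s + y) := by
    have := continuous_airyAi
    fun_prop
  have h1 : (fun ξ => shiftedAiryKernel ξ x y) = fun ξ => shiftedAiryKernel 0 x y -
      ∫ s in (0 : ℝ)..ξ, airyAi (s + x) * airyAi (s + y) := by
    ext ξ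
    rw [shiftedAiryKernel_eq_integral_Ioi, shiftedAiryKernel_eq_integral_Ioi,
      ← intervalIntegral.integral_Ioi_sub_Ioi' (integrableOn_Ioi_airyAi_mul x y 0)
        (integrableOn_Ioi_airyAi_mul x y ξ)]
    ring
  rw [h1]
  exact (intervalIntegral.integral_hasDerivAt_right (hc.intervalIntegrable _ _)
    hc.stronglyMeasurable.stronglyMeasurableAtFilter hc.continuousAt).const_sub _

theorem shiftedAiryKernel_comm (ξ x y : ℝ) :
    shiftedAiryKernel ξ x y = shiftedAiryKernel ξ y x := by
  simp only [shiftedAiryKernel, airyKernel, mul_comm]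

theorem measurable_shiftedAiryKernel (ξ : ℝ) :
    Measurable (Function.uncurry (shiftedAiryKernel ξ)) := by
  have hc := continuous_airyAi
  have hm : Measurable fun q : (ℝ × ℝ) × ℝ =>
      airyAi (ξ + q.1.1 + q.2) * airyAi (ξ + q.1.2 + q.2) :=
    Continuous.measurable (by fun_prop)
  exact hm.stronglyMeasurable.integral_prod_right.measurable

theorem exists_shiftedAiryKernel_bound : ∃ C, 0 < C ∧ ∀ ξ x y,
    |shiftedAiryKernel ξ x y| ≤ C * Real.exp (-(2 * ξ)) * Real.exp (-x) * Real.exp (-y) := by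
  obtain ⟨C, hC, h, -⟩ := exists_airyAi_bound
  refine ⟨C ^ 2, by positivity, fun ξ x y => ?_⟩
  have h1 : |shiftedAiryKernel ξ x y| ≤ ∫ s, C ^ 2 * Real.exp (-(2 * ξ)) * Real.exp (-x) *
      Real.exp (-y) * Real.exp (-(2 * s)) ∂volPos := by
    rw [← Real.norm_eq_abs]
    refine norm_integral_le_of_norm_le ((integrable_exp_neg_mul_pos two_pos).const_mul _)
      (Filter.Eventually.of_forall fun s => ?_)
    rw [norm_mul, Real.norm_eq_abs, Real.norm_eq_abs]
    refine (mul_le_mul (h _) (h _) (abs_nonneg _) (by positivity)).trans_eq ?_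
    rw [← exp_neg_sq, ← exp_neg_sq, neg_add, neg_add, neg_add, neg_add, Real.exp_add,
      Real.exp_add, Real.exp_add, Real.exp_add]
    ring
  rw [integral_const_mul, integral_exp_neg_mul_pos two_pos] at h1
  have h2 : 0 ≤ C ^ 2 * Real.exp (-(2 * ξ)) * Real.exp (-x) * Real.exp (-y) := by positivity
  linarith

/-- The operator with kernel `K_{Ai, ξ}` on `L²(ℝ₊)`. -/
def airyOp (ξ : ℝ) : L2Pos →L[ℝ] L2Pos := kernelOp (shiftedAiryKernel ξ)

/-- The operator with kernel `Ai (ξ + x + y)` on `L²(ℝ₊)`. -/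
def airyHankel (ξ : ℝ) : L2Pos →L[ℝ] L2Pos := kernelOp (sumKernel fun v => airyAi (ξ + v))

theorem exists_expBound₂_shiftedAiryKernel : ∃ C, 0 < C ∧ ∀ ξ,
    ExpBound₂ (C * Real.exp (-(2 * ξ))) (shiftedAiryKernel ξ) := by
  obtain ⟨C, hC, h⟩ := exists_shiftedAiryKernel_bound
  exact ⟨C, hC, fun ξ => ⟨measurable_shiftedAiryKernel ξ, fun x y _ _ => h ξ x y⟩⟩

theorem isHSKernel_shiftedAiryKernel (ξ : ℝ) : IsHSKernel (shiftedAiryKernel ξ) := by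
  obtain ⟨C, hC, h⟩ := exists_expBound₂_shiftedAiryKernel
  exact (h ξ).isHSKernel

theorem inner_airyOp_comm (ξ : ℝ) (f g : L2Pos) :
    inner ℝ (airyOp ξ f) g = inner ℝ f (airyOp ξ g) :=
  inner_kernelOp_comm (isHSKernel_shiftedAiryKernel ξ) (shiftedAiryKernel_comm ξ) f g

theorem sumKernel_comm (A : ℝ → ℝ) (x y : ℝ) : sumKernel A x y = sumKernel A y x := by
  rw [sumKernel, sumKernel, add_comm]

theorem exists_expBound₂_sumKernel_airyAi (ξ : ℝ) :
    ∃ C, ExpBound₂ C (sumKernel fun v => airyAi (ξ + v)) := by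
  obtain ⟨C, hC, h, -⟩ := exists_airyAi_bound
  refine ⟨C * Real.exp (-ξ), ?_, fun x y _ _ => (h _).trans_eq ?_⟩
  · have := continuous_airyAi
    unfold sumKernel Function.uncurry
    exact Continuous.measurable (by fun_prop)
  · rw [neg_add, neg_add, Real.exp_add, Real.exp_add]
    ring

theorem isHSKernel_sumKernel_airyAi (ξ : ℝ) : IsHSKernel (sumKernel fun v => airyAi (ξ + v)) := by
  obtain ⟨C, h⟩ := exists_expBound₂_sumKernel_airyAi ξ
  exact h.isHSKernel

theorem inner_airyHankel_comm (ξ : ℝ) (f g : L2Pos) :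
    inner ℝ (airyHankel ξ f) g = inner ℝ f (airyHankel ξ g) :=
  inner_kernelOp_comm (isHSKernel_sumKernel_airyAi ξ) (sumKernel_comm _) f g

theorem airyHankel_mul_airyHankel (ξ : ℝ) : airyHankel ξ * airyHankel ξ = airyOp ξ := by
  obtain ⟨C, h⟩ := exists_expBound₂_sumKernel_airyAi ξ
  refine (kernelOp_comp h h).trans ?_
  rw [airyOp]
  congr 1
  ext x z
  rw [compKernel, shiftedAiryKernel, airyKernel]
  congr 1
  ext s
  rw [sumKernel, sumKernel]
  congr 2 <;> ring

/-- The rank one operator `Ai(ξ + ·) ⊗ Ai(ξ + ·)`, minus the derivative of `airyOp` in `ξ`. -/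
def airyTensor (ξ : ℝ) : L2Pos →L[ℝ] L2Pos :=
  kernelOp (tensorKernel (fun v => airyAi (ξ + v)) fun v => airyAi (ξ + v))

theorem isHSKernel_airyTensor (ξ : ℝ) :
    IsHSKernel (tensorKernel (fun v => airyAi (ξ + v)) fun v => airyAi (ξ + v)) := by
  obtain ⟨C, -, h, -⟩ := exists_airyAi_bound
  have := expBound_shift continuous_airyAi.measurable h ξ
  exact (this.tensorKernel this).isHSKernel

theorem airyTensor_apply (ξ : ℝ) (f : L2Pos) :
    airyTensor ξ f = (inner ℝ (airyVec ξ) f : ℝ) • airyVec ξ :=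
  kernelOp_tensorKernel (isHSKernel_airyTensor ξ) (memLp_airyAi_shift ξ) (memLp_airyAi_shift ξ) f

/-- The Taylor remainder of the kernel is at most a constant times `t² exp (-x-y)`: the second
`ξ`-derivative consists of two products `Ai' Ai`. The Hilbert-Schmidt bound transfers this to the
operator norm. -/
theorem hasDerivAt_airyOp (ξ : ℝ) : HasDerivAt airyOp (-airyTensor ξ) ξ := by
  obtain ⟨C, hC, h0, h1, -⟩ := exists_airyAi_bound
  refine hasDerivAt_of_quadratic (D := 2 * C ^ 2 * Real.exp (1 - ξ) ^ 2) fun t ht => ?_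
  set T := tensorKernel (fun v => airyAi (ξ + v)) fun v => airyAi (ξ + v) with hT
  set k : ℝ → ℝ → ℝ := fun x y =>
    shiftedAiryKernel (ξ + t) x y - shiftedAiryKernel ξ x y - (-t) * T x y with hk
  have hT' := isHSKernel_airyTensor ξ
  have hK := isHSKernel_shiftedAiryKernel ξ
  have hK' := isHSKernel_shiftedAiryKernel (ξ + t)
  have hKK : IsHSKernel fun x y => shiftedAiryKernel (ξ + t) x y - shiftedAiryKernel ξ x y :=
    MemLp.sub hK' hK
  have hcT : IsHSKernel fun x y => -t * T x y := MemLp.const_mul hT' (-t)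
  have he : airyOp (ξ + t) - airyOp ξ - t • (-airyTensor ξ) = kernelOp k := by
    rw [hk, kernelOp_sub hKK hcT, kernelOp_sub hK' hK,
      kernelOp_const_mul _ hT', airyOp, airyOp, airyTensor, neg_smul, smul_neg]
  have hb : ExpBound₂ (2 * C ^ 2 * Real.exp (1 - ξ) ^ 2 * t ^ 2) k := by
    constructor
    · have hc := continuous_airyAi
      have hTm : Measurable (Function.uncurry T) := by
        rw [hT]
        unfold tensorKernel Function.uncurry
        exact Continuous.measurable (by fun_prop)
      exact ((measurable_shiftedAiryKernel _).sub (measurable_shiftedAiryKernel _)).sub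
        (hTm.const_mul _)
    · intro x y _ _
      have hd : ∀ s, HasDerivAt (fun ξ => -(airyAi (ξ + x) * airyAi (ξ + y)))
          (-(deriv airyAi (s + x) * airyAi (s + y) + airyAi (s + x) * deriv airyAi (s + y))) s :=
        fun s => (((hasDerivAt_airyAi _).comp_add_const s x).mul
          ((hasDerivAt_airyAi _).comp_add_const s y)).neg
      have h := abs_sub_sub_mul_deriv_le (g := fun ξ => shiftedAiryKernel ξ x y)
        (ξ := ξ) (D := 2 * C ^ 2 * Real.exp (1 - ξ) ^ 2 * (Real.exp (-x) * Real.exp (-y)))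
        (fun s => hasDerivAt_shiftedAiryKernel s x y) hd (fun s hs => by
          have e : ∀ {g : ℝ → ℝ}, (∀ x, |g x| ≤ C * Real.exp (-x)) → ∀ v,
              |g (s + v)| ≤ C * (Real.exp (1 - ξ) * Real.exp (-v)) := fun hg v =>
            (hg _).trans (mul_le_mul_of_nonneg_left (exp_neg_add_le hs) hC.le)
          rw [abs_neg]
          refine (abs_add_le _ _).trans ?_
          rw [abs_mul, abs_mul]
          have i1 := mul_le_mul (e h1 x) (e h0 y) (abs_nonneg _) (by positivity)
          have i2 := mul_le_mul (e h0 x) (e h1 y) (abs_nonneg _) (by positivity)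
          linarith) ht
      have e2 : k x y = shiftedAiryKernel (ξ + t) x y - shiftedAiryKernel ξ x y -
          t * -(airyAi (ξ + x) * airyAi (ξ + y)) := by
        simp only [hk, hT, tensorKernel]
        ring
      rw [e2]
      exact h.trans_eq (by ring)
  rw [he]
  exact hb.norm_kernelOp_le

theorem tendsto_airyOp_atTop : Filter.Tendsto airyOp Filter.atTop (nhds 0) := by
  obtain ⟨C, hC, h⟩ := exists_expBound₂_shiftedAiryKernel
  refine squeeze_zero_norm (fun ξ => (h ξ).norm_kernelOp_le) ?_
  have h2 : Filter.Tendsto (fun ξ : ℝ => Real.exp (-(2 * ξ))) Filter.atTop (nhds 0) :=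
    Real.tendsto_exp_neg_atTop_nhds_zero.comp (Filter.tendsto_id.const_mul_atTop two_pos)
  simpa using h2.const_mul C

/-- A curve that tends to `0` and whose derivative lies in a closed subspace stays in it. -/
theorem mem_of_hasDerivAt_mem {E : Type*} [NormedAddCommGroup E] [NormedSpace ℝ E]
    (S : Submodule ℝ E) (hS : IsClosed (S : Set E)) {F F' : ℝ → E}
    (hF : ∀ ξ, HasDerivAt F (F' ξ) ξ) (hF' : ∀ ξ, F' ξ ∈ S)
    (h0 : Filter.Tendsto F Filter.atTop (nhds 0)) (ξ : ℝ) : F ξ ∈ S := by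
  -- In the quotient by `S` the curve has derivative zero, hence is constant, and its limit at
  -- infinity is `0`. Closedness of `S` makes limits in the quotient unique.
  have hS' := hS
  let π : E →L[ℝ] E ⧸ S := S.mkQ.mkContinuous 1 fun m => by
    rw [one_mul]
    exact Submodule.Quotient.norm_mk_le S m
  have hπ : ∀ T, π T = 0 ↔ T ∈ S := fun T => Submodule.Quotient.mk_eq_zero S
  have hd : ∀ ξ, HasDerivAt (fun ξ => π (F ξ)) 0 ξ := by
    intro ξ
    have h1 := (π.hasFDerivAt (x := F ξ)).comp_hasDerivAt ξ (hF ξ)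
    rwa [(hπ _).2 (hF' ξ)] at h1
  have hc : ∀ ζ, π (F ζ) = π (F ξ) := fun ζ =>
    is_const_of_deriv_eq_zero (fun x => (hd x).differentiableAt) (fun x => (hd x).deriv) ζ ξ
  have h0 : Filter.Tendsto (fun ζ => π (F ζ)) Filter.atTop (nhds (π 0)) :=
    (π.continuous.tendsto 0).comp h0
  rw [map_zero] at h0
  simp_rw [hc] at h0
  exact (hπ _).1 (tendsto_nhds_unique tendsto_const_nhds h0)

/-- The derivative in `ξ` has rank one, the curve tends to `0`, and the compact operators form a
closed subspace. -/
theorem isCompactOperator_airyOp (ξ : ℝ) : IsCompactOperator (airyOp ξ) :=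
  mem_of_hasDerivAt_mem (compactOperator (RingHom.id ℝ) L2Pos L2Pos)
    isClosed_setOfPred_isCompactOperator hasDerivAt_airyOp
    (fun ξ => Submodule.neg_mem _
      (isCompactOperator_kernelOp_tensorKernel (isHSKernel_airyTensor ξ)
        (memLp_airyAi_shift ξ) (memLp_airyAi_shift ξ))) tendsto_airyOp_atTop ξ

/-! ## Plancherel's theorem and invertibility of `1 - K` -/

section Plancherel

open scoped FourierTransform SchwartzMap ENNReal

theorem continuous_fourier_of_integrable {f : ℝ → ℂ} (hf : Integrable f) : Continuous (𝓕 f) :=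
  VectorFourier.fourierIntegral_continuous Real.continuous_fourierChar continuous_inner hf

theorem norm_fourier_le_integral (f : ℝ → ℂ) (w : ℝ) : ‖𝓕 f w‖ ≤ ∫ v, ‖f v‖ := by
  rw [Real.fourier_real_eq]
  refine (norm_integral_le_integral_norm _).trans_eq ?_
  simp

/-- Plancherel's theorem for the Fourier integral of a function in `L¹ ∩ L²`. -/
theorem eLpNorm_fourier_eq {f : ℝ → ℂ} (hf : Integrable f) (hf2 : MemLp f 2) :
    eLpNorm (𝓕 f) 2 volume = eLpNorm f 2 volume := by
  set F : Lp ℂ 2 (volume : Measure ℝ) := hf2.toLp with hF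
  -- The Fourier integral is identified with the `L²` Fourier transform by pairing both with smooth
  -- compactly supported functions: one side uses the distributional definition, the other the
  -- exchange formula for `L¹` functions.
  have hae : 𝓕 f =ᵐ[volume] (𝓕 F : Lp ℂ 2 (volume : Measure ℝ)) := by
    refine ae_eq_of_integral_contDiff_smul_eq
      (continuous_fourier_of_integrable hf).locallyIntegrable
      ((Lp.memLp (𝓕 F)).locallyIntegrable one_le_two) fun g hg hgc => ?_
    have h1 : HasCompactSupport (Complex.ofRealCLM ∘ g) := hgc.comp_left rfl
    have h2 : ContDiff ℝ (⊤ : ℕ∞) (Complex.ofRealCLM ∘ g) :=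
      Complex.ofRealCLM.contDiff.comp hg
    set φ : 𝓢(ℝ, ℂ) := h1.toSchwartzMap h2 with hφ
    have e1 : ∫ x, g x • (𝓕 F : Lp ℂ 2 (volume : Measure ℝ)) x = ∫ x, 𝓕 φ x • F x := by
      have h3 := congrArg (fun T => T φ) (Lp.fourier_toTemperedDistribution_eq F)
      simp only [TemperedDistribution.fourier_apply, Lp.toTemperedDistribution_apply] at h3
      rw [h3]
      simp [hφ]
    have e2 : ∫ x, g x • 𝓕 f x = ∫ x, 𝓕 φ x • f x := by
      have h3 := VectorFourier.integral_fourierIntegral_smul_eq_flip (μ := volume) (ν := volume)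
        (L := innerₗ ℝ) (f := φ) (g := f)
        Real.continuous_fourierChar continuous_inner φ.integrable hf
      rw [flip_innerₗ] at h3
      refine Eq.trans ?_ (h3.symm.trans ?_)
      · refine integral_congr_ae (Filter.Eventually.of_forall fun x => ?_)
        have h4 : φ x = (g x : ℂ) := by simp [hφ]
        simp only [h4, Complex.real_smul, smul_eq_mul]
        rfl
      · rfl
    rw [e1, e2]
    refine integral_congr_ae ?_
    filter_upwards [hf2.coeFn_toLp] with x hx
    rw [hF, hx]
  rw [eLpNorm_congr_ae hae, ← eLpNorm_congr_ae hf2.coeFn_toLp, ← hF]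
  have h := Lp.norm_fourier_eq F
  rw [Lp.norm_def, Lp.norm_def] at h
  exact (ENNReal.toReal_eq_toReal_iff' (Lp.memLp _).2.ne (Lp.memLp _).2.ne).1 h

/-- `exp (-a s) f(s)` on `ℝ₊`, extended by zero. -/
def expWeighted (f : L2Pos) (a : ℝ) : ℝ → ℂ :=
  (Ioi (0 : ℝ)).indicator fun s => ((Real.exp (-(a * s)) * f s : ℝ) : ℂ)

theorem aestronglyMeasurable_exp_mul (f : L2Pos) (a : ℝ) :
    AEStronglyMeasurable (fun s => ((Real.exp (-(a * s)) * f s : ℝ) : ℂ)) volPos := by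
  have h1 : Continuous fun s : ℝ => Real.exp (-(a * s)) := by fun_prop
  exact Complex.continuous_ofReal.comp_aestronglyMeasurable
    (h1.aestronglyMeasurable.mul (Lp.aestronglyMeasurable f))

theorem eLpNorm_expWeighted_le (f : L2Pos) {a : ℝ} (ha : 0 < a) :
    eLpNorm (expWeighted f a) 2 volume ≤ eLpNorm f 2 volPos := by
  rw [expWeighted, eLpNorm_indicator_eq_eLpNorm_restrict measurableSet_Ioi]
  refine eLpNorm_mono_ae ?_
  filter_upwards [ae_volPos_pos] with s hs
  rw [Complex.norm_real, norm_mul, Real.norm_eq_abs, Real.abs_exp]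
  refine mul_le_of_le_one_left (norm_nonneg _) (Real.exp_le_one_iff.2 ?_)
  have := mul_pos ha hs
  linarith

theorem memLp_expWeighted (f : L2Pos) {a : ℝ} (ha : 0 < a) : MemLp (expWeighted f a) 2 :=
  ⟨(aestronglyMeasurable_indicator_iff measurableSet_Ioi).2 (aestronglyMeasurable_exp_mul f a),
    (eLpNorm_expWeighted_le f ha).trans_lt (Lp.memLp f).2⟩

theorem integrable_expWeighted (f : L2Pos) {a : ℝ} (ha : 0 < a) :
    Integrable (expWeighted f a) := by
  rw [expWeighted, integrable_indicator_iff measurableSet_Ioi, IntegrableOn]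
  have he : MemLp (fun x : ℝ => Real.exp (-(a * x))) 2 volPos := by
    refine (memLp_two_iff_integrable_sq (by fun_prop)).2 ?_
    refine (integrable_exp_neg_mul_pos (by positivity : 0 < 2 * a)).congr
      (Filter.Eventually.of_forall fun x => ?_)
    simp only [← Real.exp_nat_mul]
    congr 1
    push_cast
    ring
  exact (he.integrable_mul (Lp.memLp f)).ofReal

/-- `x ↦ ∫ Ai(x + s) f(s) ds`, integrated over `ℝ₊`. -/
def airyTransform (f : L2Pos) (x : ℝ) : ℝ := ∫ s, airyAi (x + s) * f s ∂volPos

theorem airyHankel_apply_ae (ξ : ℝ) (f : L2Pos) :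
    ∀ᵐ v ∂volPos, airyHankel ξ f v = airyTransform f (ξ + v) := by
  filter_upwards [kernelOp_apply_ae (isHSKernel_sumKernel_airyAi ξ) f] with v hv
  rw [airyHankel, hv, airyTransform]
  simp_rw [sumKernel, add_assoc]

/-- The Fourier side of the Airy transform on the line `Re z = a`. -/
def airyFourier (f : L2Pos) (a w : ℝ) : ℂ := airyWeight a w * 𝓕 (expWeighted f a) w

theorem norm_airyFourier_le (f : L2Pos) (a w : ℝ) : ‖airyFourier f a w‖ ≤
    (Real.exp (a ^ 3 / 3) * ∫ s, ‖expWeighted f a s‖) *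
      Real.exp (-(a * (2 * Real.pi) ^ 2) * w ^ 2) := by
  rw [airyFourier, norm_mul, norm_airyWeight]
  have h := norm_fourier_le_integral (expWeighted f a) w
  calc _ ≤ Real.exp (a ^ 3 / 3) * Real.exp (-(a * (2 * Real.pi) ^ 2) * w ^ 2) *
        ∫ s, ‖expWeighted f a s‖ := by gcongr
    _ = _ := by ring

theorem continuous_airyFourier (f : L2Pos) {a : ℝ} (ha : 0 < a) :
    Continuous (airyFourier f a) :=
  (continuous_airyWeight a).mul (continuous_fourier_of_integrable (integrable_expWeighted f ha))

/-- Insert the contour formula for `Ai(x + s)` and exchange the integrals. With `z = a + 2πiw` the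
factor `exp (-s z)` splits into the damping `exp (-a s)` and a Fourier character, so the
`s`-integral is the Fourier transform of `expWeighted f a`. -/
theorem ofReal_airyTransform_eq (f : L2Pos) {a : ℝ} (ha : 0 < a) (x : ℝ) :
    (airyTransform f x : ℂ) = laplaceLine (airyFourier f a) a x := by
  set φ := expWeighted f a with hφ
  set E : ℝ → ℂ := fun w => airyWeight a w * Complex.exp (-((x : ℂ) * linePt a w)) with hE
  have hEi : Integrable E := integrable_mul_exp_linePt (airyGaussian_pos ha)
      (continuous_airyWeight a).aestronglyMeasurable norm_airyWeight_le _
  have hφi : Integrable φ := integrable_expWeighted f ha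
  have hint : Integrable (Function.uncurry fun w s : ℝ =>
      E w * (Complex.exp (((-2 * Real.pi * s * w : ℝ) : ℂ) * Complex.I) * φ s))
      (volume.prod volume) := by
    have h1 : Integrable (fun p : ℝ × ℝ => E p.1 * φ p.2) (volume.prod volume) :=
      hEi.mul_prod hφi
    have h2 : Continuous fun p : ℝ × ℝ =>
        Complex.exp (((-2 * Real.pi * p.2 * p.1 : ℝ) : ℂ) * Complex.I) := by fun_prop
    refine (h1.bdd_mul (c := 1) h2.aestronglyMeasurable
      (Filter.Eventually.of_forall fun p => (Complex.norm_exp_ofReal_mul_I _).le)).congr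
      (Filter.Eventually.of_forall fun p => ?_)
    simp only [Function.uncurry]
    ring
  have e1 : laplaceLine (airyFourier f a) a x = ∫ w, ∫ s,
      E w * (Complex.exp (((-2 * Real.pi * s * w : ℝ) : ℂ) * Complex.I) * φ s) := by
    rw [laplaceLine]
    congr 1
    ext w
    rw [integral_const_mul, airyFourier, Real.fourier_real_eq_integral_exp_smul]
    simp only [hE, smul_eq_mul]
    ring
  have e2 : ∀ s, ∫ w, E w * (Complex.exp (((-2 * Real.pi * s * w : ℝ) : ℂ) * Complex.I) * φ s) =
      (Ioi (0 : ℝ)).indicator (fun s => ((airyAi (x + s) * f s : ℝ) : ℂ)) s := by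
    intro s
    by_cases hs : s ∈ Ioi (0 : ℝ)
    · rw [indicator_of_mem hs, Complex.ofReal_mul, ofReal_airyAi_eq_laplaceLine ha, laplaceLine,
        ← integral_mul_const]
      congr 1
      ext w
      rw [hφ, expWeighted, indicator_of_mem hs, hE]
      have : Complex.exp (-(((x + s : ℝ) : ℂ) * linePt a w)) =
          Complex.exp (-((x : ℂ) * linePt a w)) *
            Complex.exp (((-2 * Real.pi * s * w : ℝ) : ℂ) * Complex.I) *
            (Real.exp (-(a * s)) : ℂ) := by
        rw [Complex.ofReal_exp, ← Complex.exp_add, ← Complex.exp_add, linePt]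
        congr 1
        push_cast
        ring
      rw [this]
      simp only [Complex.ofReal_mul]
      ring
    · rw [indicator_of_notMem hs]
      simp [hφ, expWeighted, indicator_of_notMem hs]
  rw [e1, integral_integral_swap hint]
  simp_rw [e2]
  rw [integral_indicator measurableSet_Ioi, airyTransform]
  exact integral_ofReal.symm

theorem differentiable_laplaceLine_airyFourier (f : L2Pos) {a : ℝ} (ha : 0 < a) :
    Differentiable ℂ (laplaceLine (airyFourier f a) a) := fun z =>
  (hasDerivAt_laplaceLine (airyGaussian_pos ha) (continuous_airyFourier f ha).aestronglyMeasurable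
    (norm_airyFourier_le f a) z).differentiableAt

theorem continuous_airyTransform (f : L2Pos) : Continuous (airyTransform f) := by
  have h : airyTransform f = fun x : ℝ => (laplaceLine (airyFourier f 1) 1 x).re := by
    ext x
    rw [← ofReal_airyTransform_eq f one_pos, Complex.ofReal_re]
  rw [h]
  have := (differentiable_laplaceLine_airyFourier f one_pos).continuous
  fun_prop

/-- Multiplication by `exp (a x)` cancels the real part of the exponent, which leaves the Fourier
transform of `airyFourier f a`. Plancherel is used twice, and the weight in between has modulus at
most `exp (a³/3)`. -/
theorem eLpNorm_exp_mul_airyTransform_le (f : L2Pos) {a : ℝ} (ha : 0 < a) :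
    eLpNorm (fun x => Real.exp (a * x) * airyTransform f x) 2 volume ≤
      ENNReal.ofReal (Real.exp (a ^ 3 / 3)) * eLpNorm f 2 volPos := by
  have hm := (continuous_airyFourier f ha).aestronglyMeasurable (μ := volume)
  have hi : Integrable (airyFourier f a) :=
    (integrable_gaussian_mul_const _ (airyGaussian_pos ha)).mono' hm
      (Filter.Eventually.of_forall (norm_airyFourier_le f a))
  have hn : eLpNorm (airyFourier f a) 2 volume ≤
      ENNReal.ofReal (Real.exp (a ^ 3 / 3)) * eLpNorm f 2 volPos := by
    refine (eLpNorm_le_mul_eLpNorm_of_ae_le_mul (g := 𝓕 (expWeighted f a))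
      (c := Real.exp (a ^ 3 / 3)) (Filter.Eventually.of_forall fun w => ?_) 2).trans ?_
    · rw [airyFourier, norm_mul, norm_airyWeight]
      refine mul_le_mul_of_nonneg_right (mul_le_of_le_one_right (Real.exp_pos _).le ?_)
        (norm_nonneg _)
      rw [Real.exp_le_one_iff, neg_mul]
      have := airyGaussian_pos ha
      nlinarith [sq_nonneg w]
    · rw [eLpNorm_fourier_eq (integrable_expWeighted f ha) (memLp_expWeighted f ha)]
      gcongr
      exact eLpNorm_expWeighted_le f ha
  have h2 : MemLp (airyFourier f a) 2 :=
    ⟨hm, hn.trans_lt (ENNReal.mul_lt_top ENNReal.ofReal_lt_top (Lp.memLp f).2)⟩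
  refine le_trans (le_of_eq ?_) ((eLpNorm_fourier_eq hi h2).trans_le hn)
  refine eLpNorm_congr_norm_ae (Filter.Eventually.of_forall fun x => ?_)
  rw [← Complex.norm_real, Complex.ofReal_mul, ofReal_airyTransform_eq f ha]
  congr 1
  rw [laplaceLine, ← integral_const_mul, Real.fourier_real_eq_integral_exp_smul]
  congr 1
  ext w
  rw [Complex.ofReal_exp, mul_left_comm, ← Complex.exp_add, smul_eq_mul, mul_comm]
  congr 2
  rw [linePt]
  push_cast
  ring

/-- The Airy transform is a contraction of `L²`. -/
theorem eLpNorm_airyTransform_le (f : L2Pos) :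
    eLpNorm (airyTransform f) 2 volume ≤ eLpNorm f 2 volPos := by
  have ha : ∀ n : ℕ, (0 : ℝ) < 1 / ((n : ℝ) + 1) := fun n => by positivity
  have hlim : Filter.Tendsto (fun n : ℕ => 1 / ((n : ℝ) + 1)) Filter.atTop (nhds 0) :=
    tendsto_one_div_add_atTop_nhds_zero_nat
  have hc := continuous_airyTransform f
  -- Fatou's lemma along `a = 1/(n+1) → 0`, where the constants `exp (a³/3)` tend to `1`.
  have h1 := Lp.eLpNorm_lim_le_liminf_eLpNorm (p := 2) (μ := volume)
    (f := fun (n : ℕ) x => Real.exp (1 / ((n : ℝ) + 1) * x) * airyTransform f x)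
    (fun n => Continuous.aestronglyMeasurable (by fun_prop)) (airyTransform f)
    (Filter.Eventually.of_forall fun x => by
      have h : Continuous fun a : ℝ => Real.exp (a * x) * airyTransform f x := by fun_prop
      simpa [Function.comp_def] using (h.tendsto 0).comp hlim)
  have h2 : Filter.Tendsto (fun n : ℕ => ENNReal.ofReal (Real.exp ((1 / ((n : ℝ) + 1)) ^ 3 / 3)) *
      eLpNorm f 2 volPos) Filter.atTop (nhds (eLpNorm f 2 volPos)) := by
    have h : Continuous fun a : ℝ => ENNReal.ofReal (Real.exp (a ^ 3 / 3)) :=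
      ENNReal.continuous_ofReal.comp (by fun_prop)
    have h3 := (h.tendsto 0).comp hlim
    simpa using ENNReal.Tendsto.mul_const h3 (Or.inr (Lp.memLp f).2.ne)
  refine h1.trans ((Filter.liminf_le_liminf (Filter.Eventually.of_forall fun n =>
    eLpNorm_exp_mul_airyTransform_le f (ha n))).trans_eq h2.liminf_eq)

end Plancherel

theorem eq_zero_of_airyOp_eq_self {ξ : ℝ} {f : L2Pos} (hf : airyOp ξ f = f) : f = 0 := by
  have hSS : airyHankel ξ (airyHankel ξ f) = f := by
    rw [← mul_apply_eq_comp, airyHankel_mul_airyHankel, hf]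
  -- `S` is symmetric and `S² f = f`, so `‖S f‖² = ⟪f, S² f⟫ = ‖f‖²`.
  have hnorm : ‖airyHankel ξ f‖ = ‖f‖ := by
    have h : ‖airyHankel ξ f‖ ^ 2 = ‖f‖ ^ 2 := by
      rw [← real_inner_self_eq_norm_sq, ← real_inner_self_eq_norm_sq, inner_airyHankel_comm, hSS]
    exact (sq_eq_sq₀ (norm_nonneg _) (norm_nonneg _)).1 h
  have hsq : ∀ {α : Type} [MeasurableSpace α] (ν : Measure α) (g : α → ℝ),
      (eLpNorm g 2 ν) ^ 2 = ∫⁻ a, ‖g a‖ₑ ^ 2 ∂ν := by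
    intro α _ ν g
    have := eLpNorm_nnreal_pow_eq_lintegral (f := g) (μ := ν) (p := 2) (by norm_num)
    simpa using this
  set G := airyTransform f with hG
  have hGc : Continuous G := continuous_airyTransform f
  have hshift : ∫⁻ x in Ioi ξ, ‖G x‖ₑ ^ 2 = (eLpNorm f 2 volPos) ^ 2 := by
    have h1 : eLpNorm (airyHankel ξ f) 2 volPos = eLpNorm f 2 volPos := by
      rw [Lp.norm_def, Lp.norm_def] at hnorm
      exact (ENNReal.toReal_eq_toReal_iff' (Lp.memLp _).2.ne (Lp.memLp _).2.ne).1 hnorm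
    rw [← h1, hsq]
    have hp : (fun s : ℝ => ξ + s) ⁻¹' Ioi ξ = Ioi 0 := by
      ext s
      simp
    rw [← (measurePreserving_add_left volume ξ).setLIntegral_comp_preimage_emb
      (MeasurableEquiv.addLeft ξ).measurableEmbedding, hp]
    refine lintegral_congr_ae ?_
    filter_upwards [airyHankel_apply_ae ξ f] with v hv
    rw [hv]
  -- The half-line `(ξ, ∞)` already carries the mass `‖f‖²`, and contractivity allows no more on all
  -- of `ℝ`.
  have hle : ∫⁻ x in Iic ξ, ‖G x‖ₑ ^ 2 = 0 := by
    have h1 : (∫⁻ x in Ioi ξ, ‖G x‖ₑ ^ 2) + ∫⁻ x in Iic ξ, ‖G x‖ₑ ^ 2 = ∫⁻ x, ‖G x‖ₑ ^ 2 := by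
      rw [← compl_Ioi]
      exact lintegral_add_compl _ measurableSet_Ioi
    have h2 : ∫⁻ x, ‖G x‖ₑ ^ 2 ≤ (eLpNorm f 2 volPos) ^ 2 := by
      rw [← hsq]
      gcongr
      exact eLpNorm_airyTransform_le f
    rw [← h1, hshift] at h2
    have hfin : (eLpNorm f 2 volPos) ^ 2 ≠ ⊤ := ENNReal.pow_ne_top (Lp.memLp f).2.ne
    have h3 := ENNReal.le_sub_of_add_le_left hfin h2
    rwa [tsub_self, nonpos_iff_eq_zero] at h3
  have hzero : ∀ x ∈ Iio ξ, G x = 0 := by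
    have hm : Measurable fun x => ‖G x‖ₑ ^ 2 := (hGc.measurable.enorm).pow_const 2
    rw [lintegral_eq_zero_iff hm] at hle
    have h1 : G =ᵐ[volume.restrict (Iio ξ)] fun _ => 0 := by
      have h2 := ae_restrict_of_ae_restrict_of_subset (Iio_subset_Iic_self (a := ξ)) hle
      filter_upwards [h2] with x hx
      simpa using hx
    exact Measure.eqOn_open_of_ae_eq h1 isOpen_Iio hGc.continuousOn continuousOn_const
  -- `G` extends to an entire function whose zeros accumulate at `ξ - 1`.
  have hall : ∀ x : ℝ, G x = 0 := by
    set E := laplaceLine (airyFourier f 1) 1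
    have hE : ∀ x : ℝ, (G x : ℂ) = E x := ofReal_airyTransform_eq f one_pos
    have hd := differentiable_laplaceLine_airyFourier f one_pos
    have hfreq : ∃ᶠ z in nhdsWithin ((ξ - 1 : ℝ) : ℂ) {((ξ - 1 : ℝ) : ℂ)}ᶜ, E z = 0 := by
      have h1 : Filter.Tendsto (fun x : ℝ => (x : ℂ)) (nhdsWithin (ξ - 1) {ξ - 1}ᶜ)
          (nhdsWithin ((ξ - 1 : ℝ) : ℂ) {((ξ - 1 : ℝ) : ℂ)}ᶜ) :=
        tendsto_nhdsWithin_of_tendsto_nhds_of_eventually_within _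
          (Complex.continuous_ofReal.continuousAt.tendsto.mono_left nhdsWithin_le_nhds)
          (by
            filter_upwards [self_mem_nhdsWithin] with x hx
            exact fun h => hx (Complex.ofReal_injective h))
      refine h1.frequently (Filter.Eventually.frequently ?_)
      filter_upwards [nhdsWithin_le_nhds (Iio_mem_nhds (by linarith : ξ - 1 < ξ))] with x hx
      rw [← hE, hzero x hx, Complex.ofReal_zero]
    have h0 := AnalyticOnNhd.eq_of_frequently_eq (f := E) (g := fun _ => (0 : ℂ))
      (fun z _ => hd.analyticAt z) (fun z _ => analyticAt_const) hfreq
    intro x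
    have := hE x
    rw [h0] at this
    exact Complex.ofReal_eq_zero.1 this
  have hS : airyHankel ξ f = 0 := by
    rw [Lp.eq_zero_iff_ae_eq_zero]
    filter_upwards [airyHankel_apply_ae ξ f] with v hv
    rw [hv]
    exact hall _
  rw [← hSS, hS, map_zero]

/-- `1 - K_{Ai, ξ}` is invertible. -/
theorem isUnit_one_sub_airyOp (ξ : ℝ) : IsUnit (1 - airyOp ξ) := by
  -- Fredholm alternative: for a compact operator, `1` is an eigenvalue or lies in the resolvent
  -- set.
  rcases (isCompactOperator_airyOp ξ).hasEigenvalue_or_mem_resolventSet (𝕜 := ℝ) one_ne_zero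
    with h | h
  · obtain ⟨f, hf⟩ := h.exists_hasEigenvector
    refine absurd (eq_zero_of_airyOp_eq_self (ξ := ξ) ?_) hf.2
    simpa using hf.apply_eq_smul
  · rw [spectrum.mem_resolventSet_iff] at h
    simpa using h

/-! ## Hadamard's inequality -/

/-- The arithmetic-geometric mean inequality for the eigenvalues `λᵢ ≥ 0` of `M Mᵀ`, whose product
is `det² M` and whose sum is at most `n²`. It is applied in the form `λ/n ≤ exp (λ/n - 1)`. -/
theorem det_sq_le_of_abs_le_one {n : ℕ} (M : Matrix (Fin n) (Fin n) ℝ)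
    (h : ∀ i j, |M i j| ≤ 1) : M.det ^ 2 ≤ (n : ℝ) ^ n := by
  rcases n.eq_zero_or_pos with rfl | hn
  · simp
  have hn' : (0 : ℝ) < n := by exact_mod_cast hn
  have hpsd := Matrix.posSemidef_self_mul_conjTranspose M
  have hH := hpsd.isHermitian
  have h1 : M.det ^ 2 = ∏ i, hH.eigenvalues i := by
    have := hH.det_eq_prod_eigenvalues
    rw [Matrix.det_mul, Matrix.det_conjTranspose, star_trivial, ← sq] at this
    simpa using this
  have h2 : ∑ i, hH.eigenvalues i ≤ n * n := by
    have := hH.trace_eq_sum_eigenvalues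
    simp only [RCLike.ofReal_real_eq_id, id] at this
    rw [← this, Matrix.trace]
    calc ∑ i, (M * M.conjTranspose).diag i ≤ ∑ _i : Fin n, (n : ℝ) := by
          refine Finset.sum_le_sum fun i _ => ?_
          rw [Matrix.diag_apply, Matrix.mul_apply]
          calc ∑ j, M i j * M.conjTranspose j i ≤ ∑ _j : Fin n, (1 : ℝ) := by
                refine Finset.sum_le_sum fun j _ => ?_
                rw [Matrix.conjTranspose_apply, star_trivial, ← sq]
                exact (sq_le_one_iff_abs_le_one _).2 (h i j)
            _ = n := by simp
      _ = n * n := by simp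
  rw [h1]
  calc ∏ i, hH.eigenvalues i ≤ ∏ i, n * Real.exp (hH.eigenvalues i / n - 1) := by
        refine Finset.prod_le_prod (fun i _ => hpsd.eigenvalues_nonneg i) fun i _ => ?_
        have := Real.add_one_le_exp (hH.eigenvalues i / n - 1)
        rw [sub_add_cancel, div_le_iff₀ hn'] at this
        linarith
    _ = (n : ℝ) ^ n * Real.exp ((∑ i, hH.eigenvalues i) / n - n) := by
        rw [Finset.prod_mul_distrib, ← Real.exp_sum, Finset.sum_sub_distrib, Finset.sum_div]
        simp
    _ ≤ (n : ℝ) ^ n * 1 := by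
        refine mul_le_mul_of_nonneg_left (Real.exp_le_one_iff.2 ?_) (by positivity)
        rw [sub_nonpos, div_le_iff₀ hn']
        exact h2
    _ = _ := mul_one _

/-- Hadamard's inequality for matrices with entries bounded by `r i * s j`. -/
theorem abs_det_le_of_abs_le_mul {n : ℕ} (M : Matrix (Fin n) (Fin n) ℝ) {r s : Fin n → ℝ}
    (hr : ∀ i, 0 < r i) (hs : ∀ j, 0 < s j) (h : ∀ i j, |M i j| ≤ r i * s j) :
    |M.det| ≤ Real.sqrt ((n : ℝ) ^ n) * ((∏ i, r i) * ∏ j, s j) := by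
  set N : Matrix (Fin n) (Fin n) ℝ := Matrix.of fun i j => M i j / (r i * s j) with hN
  have h1 : M = Matrix.of fun i j => r i * (Matrix.of fun i j => s j * N i j) i j := by
    ext i j
    have := (hr i).ne'
    have := (hs j).ne'
    simp only [hN, Matrix.of_apply]
    field_simp
  have h2 : |N.det| ≤ Real.sqrt ((n : ℝ) ^ n) := by
    refine Real.abs_le_sqrt (det_sq_le_of_abs_le_one N fun i j => ?_)
    have := mul_pos (hr i) (hs j)
    rw [hN, Matrix.of_apply, abs_div, abs_of_pos this, div_le_one this]
    exact h i j
  have hr' : 0 < ∏ i, r i := Finset.prod_pos fun i _ => hr i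
  have hs' : 0 < ∏ i, s i := Finset.prod_pos fun i _ => hs i
  rw [h1, Matrix.det_mul_column, Matrix.det_mul_row, abs_mul, abs_mul, abs_of_pos hr',
    abs_of_pos hs']
  calc _ = |N.det| * ((∏ i, r i) * ∏ j, s j) := by ring
    _ ≤ _ := by gcongr

/-- By `nⁿ/n! ≤ eⁿ` the square of the term is at most `(C² e)ⁿ/n!`. This is written as `a * b` with
`a = (4C² e)ⁿ/n!` and `b = 4⁻ⁿ`, both summable, and `a * b ≤ (a + b)²` removes the square root. -/
theorem summable_pow_mul_sqrt_div_factorial {C : ℝ} (hC : 0 ≤ C) :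
    Summable fun n : ℕ => C ^ n * Real.sqrt ((n : ℝ) ^ n) / n.factorial := by
  have hs : Summable fun n : ℕ =>
      ((4 * C ^ 2 * Real.exp 1) ^ n / n.factorial + (1 / 4) ^ n : ℝ) :=
    (Real.summable_pow_div_factorial _).add (summable_geometric_of_lt_one (by norm_num) (by norm_num))
  refine Summable.of_nonneg_of_le (fun n => by positivity) (fun n => ?_) hs
  have hf : (0 : ℝ) < n.factorial := by exact_mod_cast n.factorial_pos
  have h1 : (n : ℝ) ^ n / n.factorial ≤ Real.exp 1 ^ n := by
    rw [← Real.exp_nat_mul, mul_one]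
    exact Real.pow_div_factorial_le_exp (n : ℝ) (Nat.cast_nonneg n) n
  set a : ℝ := (4 * C ^ 2 * Real.exp 1) ^ n / n.factorial with ha
  set b : ℝ := (1 / 4) ^ n with hb
  have ha0 : 0 ≤ a := by positivity
  have hb0 : 0 ≤ b := by positivity
  refine abs_le_of_sq_le_sq' ?_ (by positivity) |>.2
  calc (C ^ n * Real.sqrt ((n : ℝ) ^ n) / n.factorial) ^ 2
      = (C ^ 2) ^ n / n.factorial * ((n : ℝ) ^ n / n.factorial) := by
        rw [div_pow, mul_pow, Real.sq_sqrt (by positivity)]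
        field_simp
        ring
    _ ≤ (C ^ 2) ^ n / n.factorial * Real.exp 1 ^ n := by gcongr
    _ = a * b := by
        rw [ha, hb, mul_pow, mul_pow, one_div, inv_pow]
        field_simp
    _ ≤ (a + b) ^ 2 := by nlinarith

/-! ## Fredholm minors -/

/-- `K` and `f` are measurable and decay exponentially. -/
structure ExpData (C : ℝ) (K : ℝ → ℝ → ℝ) (f : ℝ → ℝ) : Prop where
  pos : 0 < C
  measurable_kernel : Measurable (Function.uncurry K)
  measurable_fun : Measurable f
  kernel_le : ∀ x y, |K x y| ≤ C * Real.exp (-x) * Real.exp (-y)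
  fun_le : ∀ x, |f x| ≤ C * Real.exp (-x)

/-- The Fredholm minor with its first row replaced by the values of `f`. -/
def borderedMinor (K : ℝ → ℝ → ℝ) (f : ℝ → ℝ) (n : ℕ) (x : Fin (n + 1) → ℝ) : ℝ :=
  ((Matrix.of fun i j => K (x i) (x j)).updateRow 0 fun j => f (x j)).det

/-- `∏ exp (-2 xᵢ)`. -/
def expProd {n : ℕ} (x : Fin n → ℝ) : ℝ := ∏ i, Real.exp (-(2 * x i))

theorem prod_exp_mul_prod_exp {n : ℕ} (x : Fin n → ℝ) :
    (∏ i, Real.exp (-x i)) * ∏ i, Real.exp (-x i) = expProd x := by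
  rw [← Finset.prod_mul_distrib, expProd]
  refine Finset.prod_congr rfl fun i _ => ?_
  rw [← sq, exp_neg_sq]

/-- Lebesgue measure on `ℝ₊ⁿ`. -/
abbrev volPosPi (n : ℕ) : Measure (Fin n → ℝ) := Measure.pi fun _ => volPos

theorem integrable_expProd (n : ℕ) : Integrable (expProd (n := n)) (volPosPi n) :=
  Integrable.fintype_prod fun _ => integrable_exp_neg_mul_pos two_pos

theorem integral_expProd (n : ℕ) : ∫ x, expProd x ∂(volPosPi n) = (1 / 2) ^ n := by
  unfold expProd
  rw [integral_fintype_prod_eq_prod (fun _ : Fin n => fun x : ℝ => Real.exp (-(2 * x)))]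
  simp only [integral_exp_neg_mul_pos two_pos, Finset.prod_const, Finset.card_univ,
    Fintype.card_fin]

theorem integral_expProd_le_one (n : ℕ) : ∫ x, expProd x ∂(volPosPi n) ≤ 1 := by
  rw [integral_expProd]
  exact pow_le_one₀ (by norm_num) (by norm_num)

section Fredholm

variable {C : ℝ} {K : ℝ → ℝ → ℝ} {f : ℝ → ℝ}

/-- The constant of Hadamard's inequality. -/
def hadamardConst (C : ℝ) (n : ℕ) : ℝ := C ^ n * Real.sqrt ((n : ℝ) ^ n)

theorem hadamardConst_nonneg (hC : 0 ≤ C) (n : ℕ) : 0 ≤ hadamardConst C n := by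
  unfold hadamardConst
  positivity

theorem ExpData.abs_fredholmMinor_le (h : ExpData C K f) {n : ℕ} (x : Fin n → ℝ) :
    |fredholmMinor K n x| ≤ hadamardConst C n * expProd x := by
  have hC := h.pos
  refine (abs_det_le_of_abs_le_mul _ (r := fun i => C * Real.exp (-x i))
    (s := fun j => Real.exp (-x j)) (fun i => by positivity) (fun j => by positivity)
    (fun i j => h.kernel_le _ _)).trans_eq ?_
  rw [Finset.prod_mul_distrib, Finset.prod_const, Finset.card_univ, Fintype.card_fin, mul_assoc,
    prod_exp_mul_prod_exp, hadamardConst]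
  ring

theorem ExpData.abs_borderedMinor_le (h : ExpData C K f) {n : ℕ} (x : Fin (n + 1) → ℝ) :
    |borderedMinor K f n x| ≤ hadamardConst C (n + 1) * (Real.exp (x 0) * expProd x) := by
  have hC := h.pos
  refine (abs_det_le_of_abs_le_mul _
    -- The row of `f` depends on the column variables only, so its row weight carries no decay in `x
    -- 0`; this accounts for the factor `exp (x 0)` in the bound.
    (r := Fin.cons C fun i : Fin n => C * Real.exp (-x i.succ))
    (s := fun j => Real.exp (-x j)) (fun i => ?_) (fun j => by positivity)
    (fun i j => ?_)).trans_eq ?_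
  · refine Fin.cases ?_ (fun i => ?_) i
    · exact hC
    · simp only [Fin.cons_succ]
      positivity
  · refine Fin.cases ?_ (fun i => ?_) i
    · rw [Matrix.updateRow_self]
      exact h.fun_le _
    · rw [Matrix.updateRow_ne (Fin.succ_ne_zero i)]
      exact h.kernel_le _ _
  · rw [← prod_exp_mul_prod_exp, hadamardConst, Fin.prod_univ_succ]
    simp only [Fin.cons_zero, Fin.cons_succ, Finset.prod_mul_distrib, Finset.prod_const,
      Finset.card_univ, Fintype.card_fin]
    rw [Fin.prod_univ_succ (fun i => Real.exp (-x i))]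
    have : Real.exp (x 0) * Real.exp (-x 0) = 1 := by rw [← Real.exp_add]; simp
    linear_combination (-(C ^ (n + 1) * Real.sqrt (((n + 1 : ℕ) : ℝ) ^ (n + 1)) *
      Real.exp (-x 0) * (∏ i : Fin n, Real.exp (-x i.succ)) ^ 2)) * this

theorem measurable_det {α : Type*} [MeasurableSpace α] {n : ℕ}
    {M : α → Matrix (Fin n) (Fin n) ℝ} (hM : ∀ i j, Measurable fun a => M a i j) :
    Measurable fun a => (M a).det := by
  simp_rw [Matrix.det_apply]
  exact Finset.measurable_sum _ fun σ _ =>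
    (Finset.measurable_prod _ fun i _ => hM _ _).const_smul _

theorem ExpData.measurable_kernel_comp (h : ExpData C K f) {n : ℕ} (i j : Fin n) :
    Measurable fun x : Fin n → ℝ => K (x i) (x j) :=
  Measurable.comp (g := Function.uncurry K) (f := fun x : Fin n → ℝ => (x i, x j))
    h.measurable_kernel ((measurable_pi_apply i).prodMk (measurable_pi_apply j))

theorem ExpData.measurable_fredholmMinor (h : ExpData C K f) (n : ℕ) :
    Measurable (fredholmMinor K n) :=
  measurable_det fun i j => h.measurable_kernel_comp i j

theorem ExpData.measurable_borderedMinor (h : ExpData C K f) (n : ℕ) :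
    Measurable (borderedMinor K f n) := by
  refine measurable_det fun i j => ?_
  refine Fin.cases ?_ (fun i => ?_) i
  · simp only [Matrix.updateRow_self]
    exact h.measurable_fun.comp (measurable_pi_apply j)
  · simp only [Matrix.updateRow_ne (Fin.succ_ne_zero i), Matrix.of_apply]
    exact h.measurable_kernel_comp i.succ j

theorem ExpData.integrable_fredholmMinor (h : ExpData C K f) (n : ℕ) :
    Integrable (fredholmMinor K n) (volPosPi n) :=
  ((integrable_expProd n).const_mul _).mono'
    (h.measurable_fredholmMinor n).aestronglyMeasurable
    (Filter.Eventually.of_forall fun x => h.abs_fredholmMinor_le x)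

theorem ExpData.abs_fredholmTerm_le (h : ExpData C K f) (n : ℕ) :
    |fredholmTerm K n| ≤ hadamardConst C n / n.factorial := by
  have h1 : |∫ x, fredholmMinor K n x ∂(volPosPi n)| ≤ hadamardConst C n := by
    have h2 := norm_integral_le_of_norm_le (f := fredholmMinor K n) ((integrable_expProd n).const_mul (hadamardConst C n))
      (Filter.Eventually.of_forall fun x => h.abs_fredholmMinor_le x)
    rw [integral_const_mul] at h2
    exact h2.trans (mul_le_of_le_one_right (hadamardConst_nonneg h.pos.le n)
      (integral_expProd_le_one n))
  rw [fredholmTerm, abs_mul, abs_div, abs_pow, abs_neg, abs_one, one_pow, Nat.abs_cast,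
    one_div, div_eq_inv_mul]
  gcongr

theorem ExpData.summable_fredholmTerm (h : ExpData C K f) : Summable (fredholmTerm K) :=
  Summable.of_norm_bounded (summable_pow_mul_sqrt_div_factorial h.pos.le)
    fun n => h.abs_fredholmTerm_le n

theorem ExpData.fredholmConverges (h : ExpData C K f) : FredholmConverges K :=
  ⟨h.integrable_fredholmMinor, h.summable_fredholmTerm⟩

/-! ## Expansion of the bordered minors -/

/-- A cyclic permutation of the variables brings `x i` to the front; acting on rows and columns at
once, it leaves the determinant unchanged. -/
theorem updateRow_det_eq_borderedMinor {n : ℕ} (x : Fin (n + 1) → ℝ) (i : Fin (n + 1)) :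
    ((Matrix.of fun i j => K (x i) (x j)).updateRow i fun j => f (x j)).det =
      borderedMinor K f n (x ∘ i.cycleRange.symm) := by
  rw [borderedMinor, ← Matrix.det_submatrix_equiv_self i.cycleRange.symm
    ((Matrix.of fun i j => K (x i) (x j)).updateRow i fun j => f (x j))]
  congr 1
  have h := Matrix.updateRow_submatrix_equiv (Matrix.of fun i j => K (x i) (x j)) 0
    (fun j => f (x (i.cycleRange.symm j))) i.cycleRange.symm i.cycleRange.symm
  rw [Fin.cycleRange_symm_zero] at h
  simp only [Equiv.symm_symm, Equiv.symm_apply_apply] at h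
  rw [← h]
  rfl

/-- Laplace expansion along the column of `y`. Row `m + 1` contributes the sign `(-1)^(m+1)`, and
moving column `m` of the remaining matrix to the front contributes `(-1)^m`; hence every term
carries the sign `-1`. -/
theorem borderedMinor_cons (K : ℝ → ℝ → ℝ) (f : ℝ → ℝ) {n : ℕ} (y : ℝ) (v : Fin (n + 1) → ℝ) :
    borderedMinor K f (n + 1) (Fin.cons y v) = f y * fredholmMinor K (n + 1) v -
      ∑ m, K (v m) y * borderedMinor K f n (v ∘ m.cycleRange.symm) := by
  rw [borderedMinor, Matrix.det_succ_column_zero, Fin.sum_univ_succ, sub_eq_add_neg,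
    ← Finset.sum_neg_distrib]
  congr 1
  · rw [Matrix.updateRow_self, fredholmMinor]
    simp only [Fin.val_zero, pow_zero, one_mul, Fin.cons_zero]
    congr 2
  · refine Finset.sum_congr rfl fun m _ => ?_
    rw [Matrix.updateRow_ne (Fin.succ_ne_zero m)]
    simp only [Matrix.of_apply, Fin.cons_zero, Fin.cons_succ, Fin.val_succ]
    set P := (((Matrix.of fun i j => K ((Fin.cons y v : Fin (n + 2) → ℝ) i)
      ((Fin.cons y v : Fin (n + 2) → ℝ) j)).updateRow 0
        fun j => f ((Fin.cons y v : Fin (n + 2) → ℝ) j)).submatrix m.succ.succAbove Fin.succ)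
      with hP
    have h1 : borderedMinor K f n (v ∘ m.cycleRange.symm) =
        (P.submatrix id m.cycleRange.symm).det := by
      rw [borderedMinor]
      congr 1
      ext i j
      refine Fin.cases ?_ (fun i => ?_) i
      · simp [hP]
      · rw [Matrix.updateRow_ne (Fin.succ_ne_zero i)]
        simp only [hP, Matrix.submatrix_apply, id, Fin.succ_succAbove_succ, Matrix.of_apply,
          Function.comp_apply, Fin.cycleRange_symm_succ]
        rw [Matrix.updateRow_ne (Fin.succ_ne_zero _)]
        simp
    rw [h1, Matrix.det_permute', Equiv.Perm.sign_symm, Fin.sign_cycleRange]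
    push_cast
    have h2 : ((-1 : ℝ) ^ (m : ℕ)) * (-1) ^ (m : ℕ) = 1 := by
      rw [← mul_pow]
      simp
    ring

theorem comp_perm_eq_piCongrLeft {n : ℕ} (σ : Equiv.Perm (Fin n)) :
    (fun x : Fin n → ℝ => x ∘ σ) = MeasurableEquiv.piCongrLeft (fun _ : Fin n => ℝ) σ.symm := by
  ext x i
  have := MeasurableEquiv.piCongrLeft_apply_apply (β := fun _ : Fin n => ℝ) σ.symm x (σ i)
  simpa using this.symm

theorem measurePreserving_comp_perm {n : ℕ} (σ : Equiv.Perm (Fin n)) :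
    MeasurePreserving (fun x : Fin n → ℝ => x ∘ σ) (volPosPi n) (volPosPi n) := by
  rw [comp_perm_eq_piCongrLeft]
  exact measurePreserving_piCongrLeft (fun _ : Fin n => volPos) σ.symm

theorem measurableEmbedding_comp_perm {n : ℕ} (σ : Equiv.Perm (Fin n)) :
    MeasurableEmbedding (fun x : Fin n → ℝ => x ∘ σ) := by
  rw [comp_perm_eq_piCongrLeft]
  exact MeasurableEquiv.measurableEmbedding _

theorem integral_comp_perm {n : ℕ} (σ : Equiv.Perm (Fin n)) (g : (Fin n → ℝ) → ℝ) :
    ∫ x, g (x ∘ σ) ∂(volPosPi n) = ∫ x, g x ∂(volPosPi n) :=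
  (measurePreserving_comp_perm σ).integral_comp (measurableEmbedding_comp_perm σ) g

theorem integrable_comp_perm {n : ℕ} (σ : Equiv.Perm (Fin n)) {g : (Fin n → ℝ) → ℝ}
    (hg : Integrable g (volPosPi n)) : Integrable (fun x => g (x ∘ σ)) (volPosPi n) :=
  (measurePreserving_comp_perm σ).integrable_comp_of_integrable hg

theorem measurePreserving_cons (n : ℕ) :
    MeasurePreserving (fun p : ℝ × (Fin n → ℝ) => (Fin.cons p.1 p.2 : Fin (n + 1) → ℝ))
      (volPos.prod (volPosPi n)) (volPosPi (n + 1)) := by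
  have h := (measurePreserving_piFinSuccAbove (fun _ : Fin (n + 1) => volPos) 0).symm
  convert h using 1
  ext p
  simp [MeasurableEquiv.piFinSuccAbove]

theorem measurableEmbedding_cons (n : ℕ) :
    MeasurableEmbedding (fun p : ℝ × (Fin n → ℝ) => (Fin.cons p.1 p.2 : Fin (n + 1) → ℝ)) := by
  have h := (MeasurableEquiv.piFinSuccAbove (fun _ : Fin (n + 1) => ℝ) 0).symm.measurableEmbedding
  convert h using 1
  ext p
  simp [MeasurableEquiv.piFinSuccAbove]

theorem integral_cons {n : ℕ} {g : (Fin (n + 1) → ℝ) → ℝ} (hg : Integrable g (volPosPi (n + 1))) :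
    ∫ x, g x ∂(volPosPi (n + 1)) = ∫ y, ∫ u, g (Fin.cons y u) ∂(volPosPi n) ∂volPos := by
  rw [← (measurePreserving_cons n).integral_comp (measurableEmbedding_cons n) g]
  exact integral_prod _ ((measurePreserving_cons n).integrable_comp_of_integrable hg)

/-- The integral of the bordered minor over all variables but the first. -/
def borderedIntegral (K : ℝ → ℝ → ℝ) (f : ℝ → ℝ) (n : ℕ) (y : ℝ) : ℝ :=
  ∫ u : Fin n → ℝ, borderedMinor K f n (Fin.cons y u) ∂(volPosPi n)

theorem ExpData.abs_borderedMinor_cons_le (h : ExpData C K f) {n : ℕ} (y : ℝ) (u : Fin n → ℝ) :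
    |borderedMinor K f n (Fin.cons y u)| ≤
      hadamardConst C (n + 1) * Real.exp (-y) * expProd u := by
  refine (h.abs_borderedMinor_le _).trans_eq ?_
  rw [expProd, Fin.prod_univ_succ, expProd]
  simp only [Fin.cons_zero, Fin.cons_succ]
  rw [← exp_neg_sq, mul_assoc]
  congr 1
  have : Real.exp y * Real.exp (-y) = 1 := by rw [← Real.exp_add]; simp
  linear_combination (Real.exp (-y) * ∏ i, Real.exp (-(2 * u i))) * this

theorem ExpData.expBound_borderedIntegral (h : ExpData C K f) (n : ℕ) :
    ExpBound (hadamardConst C (n + 1)) (borderedIntegral K f n) := by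
  constructor
  · have hm : Measurable fun p : ℝ × (Fin n → ℝ) =>
        borderedMinor K f n (Fin.cons p.1 p.2) :=
      (h.measurable_borderedMinor n).comp (measurableEmbedding_cons n).measurable
    exact hm.stronglyMeasurable.integral_prod_right.measurable
  · intro y _
    have h2 := norm_integral_le_of_norm_le
      (f := fun u => borderedMinor K f n (Fin.cons y u))
      ((integrable_expProd n).const_mul (hadamardConst C (n + 1) * Real.exp (-y)))
      (Filter.Eventually.of_forall fun u => h.abs_borderedMinor_cons_le y u)
    rw [integral_const_mul] at h2
    exact h2.trans (mul_le_of_le_one_right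
      (mul_nonneg (hadamardConst_nonneg h.pos.le _) (Real.exp_pos _).le)
      (integral_expProd_le_one n))

theorem ExpData.abs_mul_borderedMinor_le (h : ExpData C K f) {g : ℝ → ℝ} {D : ℝ}
    (hg : ∀ x, |g x| ≤ D * Real.exp (-x)) {n : ℕ} (x : Fin (n + 1) → ℝ) :
    |g (x 0) * borderedMinor K f n x| ≤ D * hadamardConst C (n + 1) * expProd x := by
  rw [abs_mul]
  refine (mul_le_mul (hg _) (h.abs_borderedMinor_le x) (abs_nonneg _)
    ((abs_nonneg _).trans (hg _))).trans_eq ?_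
  have : Real.exp (-x 0) * Real.exp (x 0) = 1 := by rw [← Real.exp_add]; simp
  linear_combination (D * hadamardConst C (n + 1) * expProd x) * this

theorem ExpData.integrable_mul_borderedMinor (h : ExpData C K f) {g : ℝ → ℝ} {D : ℝ}
    (hgm : Measurable g) (hg : ∀ x, |g x| ≤ D * Real.exp (-x)) (n : ℕ) :
    Integrable (fun x : Fin (n + 1) → ℝ => g (x 0) * borderedMinor K f n x)
      (volPosPi (n + 1)) :=
  ((integrable_expProd (n + 1)).const_mul _).mono'
    ((hgm.comp (measurable_pi_apply 0)).mul (h.measurable_borderedMinor n)).aestronglyMeasurable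
    (Filter.Eventually.of_forall fun x => h.abs_mul_borderedMinor_le hg x)

theorem ExpData.integral_mul_borderedMinor (h : ExpData C K f) {g : ℝ → ℝ} {D : ℝ}
    (hgm : Measurable g) (hg : ∀ x, |g x| ≤ D * Real.exp (-x)) (n : ℕ) :
    ∫ x : Fin (n + 1) → ℝ, g (x 0) * borderedMinor K f n x ∂(volPosPi (n + 1)) =
      ∫ y, g y * borderedIntegral K f n y ∂volPos := by
  rw [integral_cons (h.integrable_mul_borderedMinor hgm hg n)]
  simp_rw [Fin.cons_zero, integral_const_mul]
  rfl

/-- Fredholm's recursion. The `n + 1` terms of `borderedMinor_cons` have equal integrals because the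
product measure is invariant under permutations of the variables. -/
theorem ExpData.borderedIntegral_succ (h : ExpData C K f) (n : ℕ) (y : ℝ) :
    borderedIntegral K f (n + 1) y =
      f y * ∫ x, fredholmMinor K (n + 1) x ∂(volPosPi (n + 1)) -
        (n + 1) * ∫ w, K w y * borderedIntegral K f n w ∂volPos := by
  have hgm : Measurable fun w => K w y :=
    Measurable.comp (g := Function.uncurry K) (f := fun w : ℝ => (w, y))
      h.measurable_kernel (by fun_prop)
  have hg : ∀ w, |K w y| ≤ C * Real.exp (-y) * Real.exp (-w) := fun w =>
    (h.kernel_le w y).trans_eq (by ring)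
  have hi := h.integrable_mul_borderedMinor hgm hg n
  have hterm : ∀ m : Fin (n + 1), ∀ v : Fin (n + 1) → ℝ,
      K (v m) y * borderedMinor K f n (v ∘ m.cycleRange.symm) =
        (fun x : Fin (n + 1) → ℝ => K (x 0) y * borderedMinor K f n x)
          (v ∘ m.cycleRange.symm) := by
    intro m v
    simp [Fin.cycleRange_symm_zero]
  simp_rw [borderedIntegral, borderedMinor_cons, hterm]
  rw [integral_sub ((h.integrable_fredholmMinor (n + 1)).const_mul _)
    (integrable_finsetSum _ fun m _ => integrable_comp_perm _ hi),
    integral_const_mul, integral_finsetSum _ fun m _ => integrable_comp_perm _ hi]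
  simp_rw [fun m : Fin (n + 1) => integral_comp_perm m.cycleRange.symm
    (fun x : Fin (n + 1) → ℝ => K (x 0) y * borderedMinor K f n x)]
  rw [h.integral_mul_borderedMinor hgm hg n]
  simp [borderedIntegral]

/-! ## Dependence of the Fredholm determinant on a parameter -/

/-- The determinant is multilinear in the rows, so the product rule replaces one row at a time. -/
theorem hasDerivAt_det {n : ℕ} {M : ℝ → Matrix (Fin n) (Fin n) ℝ} {M' : Matrix (Fin n) (Fin n) ℝ}
    {ξ : ℝ} (hM : ∀ i j, HasDerivAt (fun t => M t i j) (M' i j) ξ) :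
    HasDerivAt (fun t => (M t).det) (∑ i, ((M ξ).updateRow i (M' i)).det) ξ := by
  have h : ∀ i, HasDerivAt (fun t => M t i) (M' i) ξ := fun i => hasDerivAt_pi.2 fun j => hM i j
  let D : ContinuousMultilinearMap ℝ (fun _ : Fin n => Fin n → ℝ) ℝ :=
    { (Matrix.detRowAlternating (n := Fin n) (R := ℝ)).toMultilinearMap with
      cont := (continuous_id.matrix_det : Continuous fun M : Matrix (Fin n) (Fin n) ℝ => M.det) }
  have hD := (HasFDerivAt.multilinear_comp D fun i => (h i).hasFDerivAt).hasDerivAt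
  refine hD.congr_deriv ?_
  simp only [sum_apply]
  refine Finset.sum_congr rfl fun i _ => ?_
  simp [D]
  rfl

theorem expProd_comp_perm {n : ℕ} (x : Fin n → ℝ) (σ : Equiv.Perm (Fin n)) :
    expProd (x ∘ σ) = expProd x :=
  Equiv.prod_comp σ fun i => Real.exp (-(2 * x i))

theorem fredholmTerm_zero (K : ℝ → ℝ → ℝ) : fredholmTerm K 0 = 1 := by
  simp [fredholmTerm, fredholmMinor, measureReal_def]

/-- The missing factor `n + 1` in the factorial is at most `2^(n+1)`, which is absorbed by doubling
`C`. -/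
theorem summable_hadamardConst_succ (hC : 0 ≤ C) :
    Summable fun n : ℕ => hadamardConst C (n + 1) / n.factorial := by
  have h := (summable_nat_add_iff 1).2 (summable_pow_mul_sqrt_div_factorial
    (mul_nonneg two_pos.le hC))
  refine Summable.of_nonneg_of_le
    (fun n => div_nonneg (hadamardConst_nonneg hC _) (Nat.cast_nonneg _)) (fun n => ?_) h
  have h1 : ((n + 1 : ℕ) : ℝ) ≤ 2 ^ (n + 1) := by exact_mod_cast (n + 1).lt_two_pow_self.le
  have hf : (0 : ℝ) < n.factorial := by exact_mod_cast n.factorial_pos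
  rw [Nat.factorial_succ, Nat.cast_mul, mul_pow, mul_assoc, ← hadamardConst, ← div_div,
    div_le_div_iff_of_pos_right hf, le_div_iff₀ (by positivity), mul_comm]
  exact mul_le_mul_of_nonneg_right h1 (hadamardConst_nonneg hC _)

/-- The derivative of the term of index `n + 1` of the Fredholm series of a family of kernels
`K` with derivative `-f ⊗ f`. -/
def fredholmDerivTerm (K : ℝ → ℝ → ℝ) (f : ℝ → ℝ) (n : ℕ) : ℝ :=
  (-1) ^ n / (n.factorial : ℝ) * ∫ y, f y * borderedIntegral K f n y ∂volPos

theorem ExpData.expBound (h : ExpData C K f) : ExpBound C f :=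
  ⟨h.measurable_fun, fun x _ => h.fun_le x⟩

theorem ExpData.expBound₂ (h : ExpData C K f) : ExpBound₂ C K :=
  ⟨h.measurable_kernel, fun x y _ _ => h.kernel_le x y⟩

/-- The vector `((-1)ⁿ / n!) Bₙ`, where `Bₙ` is the bordered integral. -/
def ExpData.vec (h : ExpData C K f) (n : ℕ) : L2Pos :=
  ((-1) ^ n / (n.factorial : ℝ)) • (h.expBound_borderedIntegral n).memLp.toLp

theorem abs_neg_one_pow_div_factorial (n : ℕ) :
    |(-1 : ℝ) ^ n / (n.factorial : ℝ)| = 1 / n.factorial := by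
  rw [abs_div, abs_pow, abs_neg, abs_one, one_pow, Nat.abs_cast]

theorem ExpData.norm_vec_le (h : ExpData C K f) (n : ℕ) :
    ‖h.vec n‖ ≤ hadamardConst C (n + 1) / n.factorial := by
  rw [ExpData.vec, norm_smul, Real.norm_eq_abs, abs_neg_one_pow_div_factorial, div_mul_eq_mul_div,
    one_mul]
  gcongr
  exact (h.expBound_borderedIntegral n).norm_toLp_le

theorem ExpData.summable_vec (h : ExpData C K f) : Summable h.vec :=
  Summable.of_norm_bounded (summable_hadamardConst_succ h.pos.le) h.norm_vec_le

theorem ExpData.fredholmDerivTerm_eq_inner (h : ExpData C K f) (n : ℕ) :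
    fredholmDerivTerm K f n = inner ℝ (h.expBound.memLp.toLp) (h.vec n) := by
  rw [ExpData.vec, inner_smul_right, inner_toLp_eq_integral, fredholmDerivTerm]

theorem ExpData.abs_fredholmDerivTerm_le (h : ExpData C K f) (n : ℕ) :
    |fredholmDerivTerm K f n| ≤ C * (hadamardConst C (n + 1) / n.factorial) := by
  rw [h.fredholmDerivTerm_eq_inner]
  exact (abs_real_inner_le_norm _ _).trans
    (mul_le_mul h.expBound.norm_toLp_le (h.norm_vec_le n) (norm_nonneg _) h.pos.le)

theorem ExpData.vec_zero (h : ExpData C K f) : h.vec 0 = h.expBound.memLp.toLp := by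
  rw [ExpData.vec, Nat.factorial_zero, pow_zero, Nat.cast_one, div_one, one_smul]
  refine MemLp.toLp_congr _ _ (Filter.Eventually.of_forall fun y => ?_)
  simp [borderedIntegral, borderedMinor, measureReal_def]

/-- The normalization `(-1)ⁿ/n!` absorbs the factor `-(n+1)` of the recursion. Symmetry of `K` is
needed since the recursion integrates over the first argument of `K`, the operator over the second.
-/
theorem ExpData.vec_succ (h : ExpData C K f) (hs : ∀ x y, K x y = K y x) (n : ℕ) :
    h.vec (n + 1) =
      fredholmTerm K (n + 1) • h.expBound.memLp.toLp + kernelOp K (h.vec n) := by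
  apply Lp.ext
  have hB := (h.expBound_borderedIntegral n).memLp
  have hB' := (h.expBound_borderedIntegral (n + 1)).memLp
  rw [ExpData.vec, ExpData.vec, map_smul]
  filter_upwards [Lp.coeFn_smul ((-1) ^ (n + 1) / ((n + 1).factorial : ℝ)) (hB'.toLp _),
    hB'.coeFn_toLp, Lp.coeFn_add (fredholmTerm K (n + 1) • h.expBound.memLp.toLp)
      (((-1) ^ n / (n.factorial : ℝ)) • kernelOp K (hB.toLp _)),
    Lp.coeFn_smul (fredholmTerm K (n + 1)) (h.expBound.memLp.toLp),
    Lp.coeFn_smul ((-1) ^ n / (n.factorial : ℝ)) (kernelOp K (hB.toLp _)),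
    h.expBound.memLp.coeFn_toLp, kernelOp_apply_ae h.expBound₂.isHSKernel (hB.toLp _)]
    with y h1 h2 h3 h4 h5 h6 h7
  have h8 : ∫ w, K y w * (hB.toLp (borderedIntegral K f n)) w ∂volPos =
      ∫ w, K w y * borderedIntegral K f n w ∂volPos := by
    refine integral_congr_ae ?_
    filter_upwards [hB.coeFn_toLp] with w hw
    rw [hw, hs]
  rw [h1, h3, Pi.smul_apply, Pi.add_apply, h4, h5, Pi.smul_apply, Pi.smul_apply, h2, h6, h7, h8,
    h.borderedIntegral_succ, fredholmTerm]
  simp only [smul_eq_mul]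
  have hf : (n.factorial : ℝ) ≠ 0 := by exact_mod_cast n.factorial_ne_zero
  have hn : ((n : ℝ) + 1) ≠ 0 := by positivity
  rw [Nat.factorial_succ]
  push_cast
  field_simp
  ring

/-- The series of the vectors solves `(1 - K) u = det (1 - K) f`. -/
theorem ExpData.one_sub_kernelOp_tsum_vec (h : ExpData C K f) (hs : ∀ x y, K x y = K y x) :
    (1 - kernelOp K) (∑' n, h.vec n) = fredholmDet K • h.expBound.memLp.toLp := by
  have h1 : ∑' n, h.vec n = h.vec 0 + ∑' n, h.vec (n + 1) := h.summable_vec.tsum_eq_zero_add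
  have h2 : ∑' n, h.vec (n + 1) = (∑' n, fredholmTerm K (n + 1)) • h.expBound.memLp.toLp +
      kernelOp K (∑' n, h.vec n) := by
    simp_rw [h.vec_succ hs]
    have s1 : Summable fun n => fredholmTerm K (n + 1) :=
      (summable_nat_add_iff 1).2 h.summable_fredholmTerm
    rw [(s1.smul_const _).tsum_add ((kernelOp K).summable h.summable_vec),
      ((kernelOp K).map_tsum h.summable_vec), s1.tsum_smul_const]
  have h3 : fredholmDet K = 1 + ∑' n, fredholmTerm K (n + 1) := by
    rw [fredholmDet, h.summable_fredholmTerm.tsum_eq_zero_add, fredholmTerm_zero]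
  rw [sub_apply, one_apply_eq_self, h3, add_smul, one_smul, ← h.vec_zero]
  nth_rewrite 1 [h1]
  rw [h2, h.vec_zero]
  abel

/-- Applying `(1 - K)⁻¹` to the equation for the vector series and pairing with `f` gives Jacobi's
formula for this rank one derivative. -/
theorem ExpData.tsum_fredholmDerivTerm (h : ExpData C K f) (hs : ∀ x y, K x y = K y x)
    (hu : IsUnit (1 - kernelOp K)) :
    ∑' n, fredholmDerivTerm K f n = fredholmDet K *
      inner ℝ (h.expBound.memLp.toLp) (Ring.inverse (1 - kernelOp K) (h.expBound.memLp.toLp)) := by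
  have h1 : ∑' n, h.vec n =
      fredholmDet K • Ring.inverse (1 - kernelOp K) (h.expBound.memLp.toLp) := by
    rw [← map_smul, ← h.one_sub_kernelOp_tsum_vec hs, ← mul_apply_eq_comp,
      Ring.inverse_mul_cancel _ hu, one_apply_eq_self]
  simp_rw [h.fredholmDerivTerm_eq_inner]
  have h2 := (innerSL ℝ (h.expBound.memLp.toLp)).map_tsum h.summable_vec
  simp only [innerSL_apply_apply] at h2
  rw [← h2, h1, inner_smul_right]

section Family

variable {ξ₀ : ℝ} {K : ℝ → ℝ → ℝ → ℝ} {f : ℝ → ℝ → ℝ}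

/-- The derivative of row `i` is `-f(xᵢ)` times the row `(f(xⱼ))ⱼ`, so each summand of the product
rule is a bordered minor with `xᵢ` moved to the front. -/
theorem hasDerivAt_fredholmMinor
    (hd : ∀ ξ x y, HasDerivAt (fun t => K t x y) (-(f ξ x * f ξ y)) ξ) (ξ : ℝ) {n : ℕ}
    (x : Fin (n + 1) → ℝ) : HasDerivAt (fun t => fredholmMinor (K t) (n + 1) x)
      (-∑ i : Fin (n + 1), (fun v : Fin (n + 1) → ℝ => f ξ (v 0) * borderedMinor (K ξ) (f ξ) n v)
        (x ∘ i.cycleRange.symm)) ξ := by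
  have h := hasDerivAt_det (M := fun t => Matrix.of fun i j => K t (x i) (x j))
    (M' := Matrix.of fun i j => -(f ξ (x i) * f ξ (x j))) (ξ := ξ) (fun i j => hd ξ (x i) (x j))
  refine h.congr_deriv ?_
  rw [← Finset.sum_neg_distrib]
  refine Finset.sum_congr rfl fun i _ => ?_
  have hr : (Matrix.of fun i j => -(f ξ (x i) * f ξ (x j))) i =
      (-f ξ (x i)) • fun j => f ξ (x j) := by
    ext j
    simp
  rw [hr, Matrix.det_updateRow_smul, updateRow_det_eq_borderedMinor]
  simp [Fin.cycleRange_symm_zero]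

theorem hasDerivAt_integral_fredholmMinor
    (h : ∀ ξ ∈ Metric.ball ξ₀ 1, ExpData C (K ξ) (f ξ))
    (hd : ∀ ξ x y, HasDerivAt (fun t => K t x y) (-(f ξ x * f ξ y)) ξ) (n : ℕ) {ξ : ℝ}
    (hξ : ξ ∈ Metric.ball ξ₀ 1) :
    HasDerivAt (fun t => ∫ x, fredholmMinor (K t) (n + 1) x ∂(volPosPi (n + 1)))
      (-((n + 1) * ∫ y, f ξ y * borderedIntegral (K ξ) (f ξ) n y ∂volPos)) ξ := by
  have hξ' := h ξ hξ
  have hi := hξ'.integrable_mul_borderedMinor hξ'.measurable_fun hξ'.fun_le n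
  have hsum : Integrable (fun x : Fin (n + 1) → ℝ => -∑ i : Fin (n + 1),
      (fun v : Fin (n + 1) → ℝ => f ξ (v 0) * borderedMinor (K ξ) (f ξ) n v)
        (x ∘ i.cycleRange.symm)) (volPosPi (n + 1)) :=
    (integrable_finsetSum _ fun i _ => integrable_comp_perm i.cycleRange.symm hi).neg
  have hD := (hasDerivAt_integral_of_dominated_loc_of_deriv_le (μ := volPosPi (n + 1))
    (F := fun t x => fredholmMinor (K t) (n + 1) x)
    (F' := fun t x => -∑ i : Fin (n + 1),
      (fun v : Fin (n + 1) → ℝ => f t (v 0) * borderedMinor (K t) (f t) n v)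
        (x ∘ i.cycleRange.symm))
    (bound := fun x => ((n + 1 : ℕ) : ℝ) * (C * hadamardConst C (n + 1) * expProd x))
    (Metric.isOpen_ball.mem_nhds hξ) ?_ (hξ'.integrable_fredholmMinor (n + 1))
    hsum.aestronglyMeasurable ?_ (((integrable_expProd _).const_mul _).const_mul _)
    (Filter.Eventually.of_forall fun x t _ => hasDerivAt_fredholmMinor hd t x)).2
  · refine hD.congr_deriv ?_
    rw [integral_neg, integral_finsetSum _ fun i _ => integrable_comp_perm i.cycleRange.symm hi]
    simp_rw [fun i : Fin (n + 1) => integral_comp_perm i.cycleRange.symm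
      (fun x : Fin (n + 1) → ℝ => f ξ (x 0) * borderedMinor (K ξ) (f ξ) n x)]
    rw [hξ'.integral_mul_borderedMinor hξ'.measurable_fun hξ'.fun_le n]
    simp
  · filter_upwards [Metric.isOpen_ball.mem_nhds hξ] with t ht
    exact ((h t ht).measurable_fredholmMinor (n + 1)).aestronglyMeasurable
  · refine Filter.Eventually.of_forall fun x t ht => ?_
    rw [norm_neg]
    refine (norm_sum_le _ _).trans ?_
    refine (Finset.sum_le_card_nsmul _ _ (C * hadamardConst C (n + 1) * expProd x)
      fun i _ => ?_).trans_eq (by simp)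
    have := (h t ht).abs_mul_borderedMinor_le (h t ht).fun_le (x ∘ i.cycleRange.symm)
    rwa [expProd_comp_perm] at this

theorem hasDerivAt_fredholmTerm
    (h : ∀ ξ ∈ Metric.ball ξ₀ 1, ExpData C (K ξ) (f ξ))
    (hd : ∀ ξ x y, HasDerivAt (fun t => K t x y) (-(f ξ x * f ξ y)) ξ) (n : ℕ) {ξ : ℝ}
    (hξ : ξ ∈ Metric.ball ξ₀ 1) :
    HasDerivAt (fun t => fredholmTerm (K t) (n + 1)) (fredholmDerivTerm (K ξ) (f ξ) n) ξ := by
  refine ((hasDerivAt_integral_fredholmMinor h hd n hξ).const_mul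
    ((-1) ^ (n + 1) / ((n + 1).factorial : ℝ))).congr_deriv ?_
  have hf : (n.factorial : ℝ) ≠ 0 := by exact_mod_cast n.factorial_ne_zero
  have hn : ((n : ℝ) + 1) ≠ 0 := by positivity
  rw [fredholmDerivTerm, Nat.factorial_succ]
  push_cast
  field_simp
  ring

/-- The derivative of the Fredholm determinant of a family of kernels with derivative
`-f ⊗ f`. -/
theorem hasDerivAt_fredholmDet
    (h : ∀ ξ ∈ Metric.ball ξ₀ 1, ExpData C (K ξ) (f ξ))
    (hd : ∀ ξ x y, HasDerivAt (fun t => K t x y) (-(f ξ x * f ξ y)) ξ) :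
    HasDerivAt (fun t => fredholmDet (K t)) (∑' n, fredholmDerivTerm (K ξ₀) (f ξ₀) n) ξ₀ := by
  have h0 : ξ₀ ∈ Metric.ball ξ₀ 1 := Metric.mem_ball_self one_pos
  have hC := (h ξ₀ h0).pos
  -- Termwise differentiation, with one summable bound on the whole ball. The sum starts at index
  -- `1`, since the term of index `0` is the constant `1`.
  have hs := hasDerivAt_tsum_of_isPreconnected (𝕜 := ℝ)
    (g := fun n t => fredholmTerm (K t) (n + 1))
    (g' := fun n t => fredholmDerivTerm (K t) (f t) n)
    ((summable_hadamardConst_succ hC.le).mul_left C) Metric.isOpen_ball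
    (convex_ball ξ₀ 1).isPreconnected (fun n t ht => hasDerivAt_fredholmTerm h hd n ht)
    (fun n t ht => (h t ht).abs_fredholmDerivTerm_le n) h0
    ((summable_nat_add_iff 1).2 (h ξ₀ h0).summable_fredholmTerm) h0
  refine (hs.const_add 1).congr_of_eventuallyEq ?_
  filter_upwards [Metric.isOpen_ball.mem_nhds h0] with t ht
  rw [fredholmDet, (h t ht).summable_fredholmTerm.tsum_eq_zero_add, fredholmTerm_zero]

end Family

end Fredholm

/-! ## The Tracy-Widom distribution function -/

theorem exists_expData_shiftedAiryKernel : ∃ C₁ C₂ : ℝ, 0 < C₁ ∧ 0 < C₂ ∧ ∀ ξ,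
    ExpData (C₁ * Real.exp (-(2 * ξ)) + C₂ * Real.exp (-ξ)) (shiftedAiryKernel ξ)
      fun v => airyAi (ξ + v) := by
  obtain ⟨C₁, h1, hK⟩ := exists_shiftedAiryKernel_bound
  obtain ⟨C₂, h2, hA, -⟩ := exists_airyAi_bound
  refine ⟨C₁, C₂, h1, h2, fun ξ => ⟨by positivity, measurable_shiftedAiryKernel ξ, ?_, ?_, ?_⟩⟩
  · have := continuous_airyAi
    exact Continuous.measurable (by fun_prop)
  · intro x y
    refine (hK ξ x y).trans ?_
    gcongr
    exact le_add_of_nonneg_right (by positivity)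
  · intro x
    refine (hA _).trans ?_
    rw [neg_add, Real.exp_add, ← mul_assoc]
    gcongr
    exact le_add_of_nonneg_left (by positivity)

theorem ExpData.mono {C D : ℝ} {K : ℝ → ℝ → ℝ} {f : ℝ → ℝ} (h : ExpData C K f) (hCD : C ≤ D) :
    ExpData D K f where
  pos := h.pos.trans_le hCD
  measurable_kernel := h.measurable_kernel
  measurable_fun := h.measurable_fun
  kernel_le x y := (h.kernel_le x y).trans (by gcongr)
  fun_le x := (h.fun_le x).trans (by gcongr)

/-- The constants decrease in `ξ`, so their value at the left end `ξ₀ - 1` serves the whole ball. -/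
theorem exists_expData_of_mem_ball (ξ₀ : ℝ) : ∃ C : ℝ, ∀ ξ ∈ Metric.ball ξ₀ 1,
    ExpData C (shiftedAiryKernel ξ) fun v => airyAi (ξ + v) := by
  obtain ⟨C₁, C₂, h1, h2, h⟩ := exists_expData_shiftedAiryKernel
  refine ⟨C₁ * Real.exp (-(2 * (ξ₀ - 1))) + C₂ * Real.exp (-(ξ₀ - 1)), fun ξ hξ =>
    (h ξ).mono ?_⟩
  rw [Metric.mem_ball, Real.dist_eq, abs_lt] at hξ
  have : ξ₀ - 1 ≤ ξ := by linarith
  gcongr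

theorem fredholmConverges_shiftedAiryKernel (ξ : ℝ) : FredholmConverges (shiftedAiryKernel ξ) := by
  obtain ⟨C₁, C₂, -, -, h⟩ := exists_expData_shiftedAiryKernel
  exact (h ξ).fredholmConverges

/-- The resolvent `(1 - K_{Ai, ξ})⁻¹`. -/
def airyResolvent (ξ : ℝ) : L2Pos →L[ℝ] L2Pos := Ring.inverse (1 - airyOp ξ)

/-- `⟪A, (1 - K_{Ai, ξ})⁻¹ A⟫` with `A = Ai (ξ + ·)`. -/
def airyLogDeriv (ξ : ℝ) : ℝ := inner ℝ (airyVec ξ) (airyResolvent ξ (airyVec ξ))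

theorem hasDerivAt_F2 (ξ : ℝ) : HasDerivAt F2 (F2 ξ * airyLogDeriv ξ) ξ := by
  obtain ⟨C, h⟩ := exists_expData_of_mem_ball ξ
  refine (hasDerivAt_fredholmDet h hasDerivAt_shiftedAiryKernel).congr_deriv ?_
  exact (h ξ (Metric.mem_ball_self one_pos)).tsum_fredholmDerivTerm (shiftedAiryKernel_comm ξ)
    (isUnit_one_sub_airyOp ξ)

theorem inner_ringInverse_comm {S T : L2Pos →L[ℝ] L2Pos} (hS : IsUnit S) (hT : IsUnit T)
    (h : ∀ f g : L2Pos, inner ℝ (S f) g = inner ℝ f (T g)) (f g : L2Pos) :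
    inner ℝ (Ring.inverse S f) g = inner ℝ f (Ring.inverse T g) := by
  have h1 : S (Ring.inverse S f) = f := by
    rw [← mul_apply_eq_comp, Ring.mul_inverse_cancel _ hS, one_apply_eq_self]
  have h2 : T (Ring.inverse T g) = g := by
    rw [← mul_apply_eq_comp, Ring.mul_inverse_cancel _ hT, one_apply_eq_self]
  have h3 := h (Ring.inverse S f) (Ring.inverse T g)
  rw [h1, h2] at h3
  exact h3.symm

theorem inner_one_sub_comm {S T : L2Pos →L[ℝ] L2Pos}
    (h : ∀ f g : L2Pos, inner ℝ (S f) g = inner ℝ f (T g)) (f g : L2Pos) :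
    inner ℝ ((1 - S) f) g = inner ℝ f ((1 - T) g) := by
  simp only [sub_apply, one_apply_eq_self, inner_sub_left, inner_sub_right, h]

theorem inner_airyResolvent_comm (ξ : ℝ) (f g : L2Pos) :
    inner ℝ (airyResolvent ξ f) g = inner ℝ f (airyResolvent ξ g) :=
  inner_ringInverse_comm (isUnit_one_sub_airyOp ξ) (isUnit_one_sub_airyOp ξ)
    (inner_one_sub_comm (inner_airyOp_comm ξ)) f g

theorem hasDerivAt_airyResolvent (ξ : ℝ) :
    HasDerivAt airyResolvent (-(airyResolvent ξ * airyTensor ξ * airyResolvent ξ)) ξ := by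
  obtain ⟨u, hu⟩ := isUnit_one_sub_airyOp ξ
  have h1 : HasDerivAt (fun ξ => 1 - airyOp ξ) (airyTensor ξ) ξ := by
    simpa using (hasDerivAt_airyOp ξ).const_sub 1
  have h2 := hasFDerivAt_ringInverse (𝕜 := ℝ) u
  rw [hu] at h2
  have h3 := h2.comp_hasDerivAt ξ h1
  have h4 : airyResolvent ξ = ↑u⁻¹ := by rw [airyResolvent, ← hu, Ring.inverse_unit]
  rw [h4]
  refine h3.congr_deriv ?_
  simp

/-- Symmetry of the resolvent makes the two terms with `A'` equal, and the rank one operator inside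
`R'` splits its term into `-⟪A, R A⟫²`. -/
theorem hasDerivAt_airyLogDeriv (ξ : ℝ) : HasDerivAt airyLogDeriv
    (2 * inner ℝ (airyDerivVec ξ) (airyResolvent ξ (airyVec ξ)) - airyLogDeriv ξ ^ 2) ξ := by
  have hA := hasDerivAt_airyVec ξ
  have h := hA.inner ℝ ((hasDerivAt_airyResolvent ξ).clm_apply hA)
  refine h.congr_deriv ?_
  rw [inner_add_right, neg_apply, inner_neg_right, mul_apply_eq_comp, mul_apply_eq_comp,
    airyTensor_apply, map_smul, inner_smul_right, ← inner_airyResolvent_comm ξ _ (airyDerivVec ξ),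
    real_inner_comm (airyDerivVec ξ)]
  simp only [airyLogDeriv]
  ring

theorem deriv_F2_eq : deriv F2 = fun ξ => F2 ξ * airyLogDeriv ξ :=
  funext fun ξ => (hasDerivAt_F2 ξ).deriv

/-- In `(F₂ q)' = F₂ (q² + q')` the two squares cancel. -/
theorem hasDerivAt_deriv_F2 (ξ : ℝ) : HasDerivAt (deriv F2)
    (2 * F2 ξ * inner ℝ (airyDerivVec ξ) (airyResolvent ξ (airyVec ξ))) ξ := by
  rw [deriv_F2_eq]
  refine ((hasDerivAt_F2 ξ).mul (hasDerivAt_airyLogDeriv ξ)).congr_deriv ?_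
  ring

/-! ### The limit at infinity and positivity -/

theorem hadamardConst_le {C : ℝ} (hC : 0 ≤ C) (hC1 : C ≤ 1) (n : ℕ) :
    hadamardConst C (n + 1) ≤ C * hadamardConst 1 (n + 1) := by
  rw [hadamardConst, hadamardConst, one_pow, one_mul, pow_succ]
  refine mul_le_mul_of_nonneg_right ?_ (Real.sqrt_nonneg _)
  exact mul_le_of_le_one_left hC (pow_le_one₀ hC hC1)

theorem ExpData.abs_fredholmDet_sub_one_le {C : ℝ} {K : ℝ → ℝ → ℝ} {f : ℝ → ℝ}
    (h : ExpData C K f) (hC : C ≤ 1) : |fredholmDet K - 1| ≤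
      C * ∑' n : ℕ, hadamardConst 1 (n + 1) / (n + 1).factorial := by
  have hs : Summable fun n : ℕ => hadamardConst 1 (n + 1) / ((n + 1).factorial : ℝ) :=
    (summable_nat_add_iff 1).2 (summable_pow_mul_sqrt_div_factorial zero_le_one)
  rw [fredholmDet, h.summable_fredholmTerm.tsum_eq_zero_add, fredholmTerm_zero,
    add_sub_cancel_left, ← tsum_mul_left, ← Real.norm_eq_abs]
  refine tsum_of_norm_bounded (hs.mul_left C).hasSum fun n => ?_
  refine (h.abs_fredholmTerm_le (n + 1)).trans ?_
  rw [← mul_div_assoc]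
  gcongr
  exact hadamardConst_le h.pos.le hC n

theorem tendsto_F2_atTop : Filter.Tendsto F2 Filter.atTop (nhds 1) := by
  obtain ⟨C₁, C₂, h1, h2, h⟩ := exists_expData_shiftedAiryKernel
  have e1 : Filter.Tendsto (fun ξ : ℝ => Real.exp (-ξ)) Filter.atTop (nhds 0) :=
    Real.tendsto_exp_neg_atTop_nhds_zero
  have e2 : Filter.Tendsto (fun ξ : ℝ => Real.exp (-(2 * ξ))) Filter.atTop (nhds 0) :=
    e1.comp (Filter.tendsto_id.const_mul_atTop two_pos)
  have hlim : Filter.Tendsto (fun ξ : ℝ => C₁ * Real.exp (-(2 * ξ)) + C₂ * Real.exp (-ξ))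
      Filter.atTop (nhds 0) := by
    simpa using (e2.const_mul C₁).add (e1.const_mul C₂)
  rw [tendsto_iff_norm_sub_tendsto_zero]
  refine squeeze_zero' (Filter.Eventually.of_forall fun ξ => norm_nonneg _) ?_
    (by simpa using hlim.mul_const (∑' n : ℕ, hadamardConst 1 (n + 1) / (n + 1).factorial))
  filter_upwards [hlim.eventually_le_const zero_lt_one] with ξ hξ
  exact (h ξ).abs_fredholmDet_sub_one_le hξ

/-- The linear equation `F₂' = q F₂` with continuous `q` makes `F₂(t) exp (-∫_ξ^t q)` constant in
`t`; for large `t` it is positive because `F₂ → 1`. -/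
theorem F2_pos (ξ : ℝ) : 0 < F2 ξ := by
  have hq : Continuous airyLogDeriv :=
    continuous_iff_continuousAt.2 fun x => (hasDerivAt_airyLogDeriv x).continuousAt
  have hd : ∀ t, HasDerivAt (fun t => F2 t * Real.exp (-∫ s in ξ..t, airyLogDeriv s)) 0 t := by
    intro t
    have h1 : HasDerivAt (fun t => ∫ s in ξ..t, airyLogDeriv s) (airyLogDeriv t) t :=
      intervalIntegral.integral_hasDerivAt_right (hq.intervalIntegrable _ _)
        hq.stronglyMeasurable.stronglyMeasurableAtFilter hq.continuousAt
    refine ((hasDerivAt_F2 t).mul h1.neg.exp).congr_deriv ?_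
    ring
  obtain ⟨t, ht⟩ := (tendsto_F2_atTop.eventually_const_lt zero_lt_one).exists
  have hc := is_const_of_deriv_eq_zero (fun t => (hd t).differentiableAt)
    (fun t => (hd t).deriv) ξ t
  simp only [intervalIntegral.integral_same, neg_zero, Real.exp_zero, mul_one] at hc
  rw [hc]
  positivity

/-! ## The conjugated operators -/

/-- The inverse is `1 + a (1 - b a)⁻¹ b`. -/
theorem isUnit_one_sub_mul_comm {R : Type*} [Ring R] {a b : R} (h : IsUnit (1 - b * a)) :
    IsUnit (1 - a * b) := by
  set r := Ring.inverse (1 - b * a)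
  have h1 : (1 - b * a) * r = 1 := Ring.mul_inverse_cancel _ h
  have h2 : r * (1 - b * a) = 1 := Ring.inverse_mul_cancel _ h
  refine ⟨⟨1 - a * b, 1 + a * r * b, ?_, ?_⟩, rfl⟩
  · calc (1 - a * b) * (1 + a * r * b) = 1 - a * b + a * ((1 - b * a) * r) * b := by noncomm_ring
      _ = 1 := by rw [h1]; noncomm_ring
  · calc (1 + a * r * b) * (1 - a * b) = 1 - a * b + a * (r * (1 - b * a)) * b := by noncomm_ring
      _ = 1 := by rw [h2]; noncomm_ring

theorem ringInverse_one_sub_mul_comm {R : Type*} [Ring R] {a b : R} (h : IsUnit (1 - b * a)) :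
    Ring.inverse (1 - a * b) * a = a * Ring.inverse (1 - b * a) := by
  have h' := isUnit_one_sub_mul_comm h
  have h1 : (1 - a * b) * (a * Ring.inverse (1 - b * a)) = a := by
    calc _ = a * ((1 - b * a) * Ring.inverse (1 - b * a)) := by noncomm_ring
      _ = a := by rw [Ring.mul_inverse_cancel _ h, mul_one]
  calc _ = Ring.inverse (1 - a * b) * ((1 - a * b) * (a * Ring.inverse (1 - b * a))) := by rw [h1]
    _ = _ := by rw [← mul_assoc, Ring.inverse_mul_cancel _ h', one_mul]

theorem AMinus_eq_APlus_neg (ξ η : ℝ) : AMinus ξ η = APlus ξ (-η) := by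
  ext v
  rw [AMinus, APlus, neg_sq]
  ring_nf

theorem APlus_eq_AMinus_neg (ξ η : ℝ) : APlus ξ η = AMinus ξ (-η) := by
  rw [AMinus_eq_APlus_neg, neg_neg]

theorem continuous_APlus (ξ η : ℝ) : Continuous (APlus ξ η) := by
  have := continuous_airyAi
  unfold APlus
  fun_prop

/-- `Ai` decays faster than every exponential: the rate `|η| + 1` beats the growth `exp (η v)` and
leaves `exp (-v)`. -/
theorem exists_expBound_APlus (ξ η : ℝ) : ∃ C, ExpBound C (APlus ξ η) := by
  obtain ⟨C, hC, h⟩ := exists_abs_airyAi_le (a := |η| + 1) (by positivity)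
  refine ⟨C * Real.exp (-((|η| + 1) * (ξ + η ^ 2)) + (ξ * η + 2 * η ^ 3 / 3)),
    (continuous_APlus ξ η).measurable, fun v hv => ?_⟩
  rw [APlus, abs_mul, Real.abs_exp]
  refine (mul_le_mul_of_nonneg_right (h _) (Real.exp_pos _).le).trans ?_
  rw [mul_assoc, mul_assoc, ← Real.exp_add, ← Real.exp_add]
  refine mul_le_mul_of_nonneg_left (Real.exp_le_exp.2 ?_) hC.le
  nlinarith [mul_le_mul_of_nonneg_right (le_abs_self η) hv.le]

theorem exists_expBound_AMinus (ξ η : ℝ) : ∃ C, ExpBound C (AMinus ξ η) := by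
  rw [AMinus_eq_APlus_neg]
  exact exists_expBound_APlus ξ (-η)

theorem ExpBound.sumKernel {C : ℝ} {A : ℝ → ℝ} (h : ExpBound C A) :
    ExpBound₂ C (sumKernel A) := by
  refine ⟨h.measurable.comp (measurable_fst.add measurable_snd), fun x y hx hy => ?_⟩
  refine (h.abs_le _ (add_pos hx hy)).trans_eq ?_
  rw [neg_add, Real.exp_add, mul_assoc]

theorem memLp_APlus (ξ η : ℝ) : MemLp (APlus ξ η) 2 volPos := by
  obtain ⟨C, h⟩ := exists_expBound_APlus ξ η
  exact h.memLp

theorem memLp_AMinus (ξ η : ℝ) : MemLp (AMinus ξ η) 2 volPos := by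
  obtain ⟨C, h⟩ := exists_expBound_AMinus ξ η
  exact h.memLp

theorem isHSKernel_sumKernel_APlus (ξ η : ℝ) : IsHSKernel (sumKernel (APlus ξ η)) := by
  obtain ⟨C, h⟩ := exists_expBound_APlus ξ η
  exact h.sumKernel.isHSKernel

theorem isHSKernel_sumKernel_AMinus (ξ η : ℝ) : IsHSKernel (sumKernel (AMinus ξ η)) := by
  obtain ⟨C, h⟩ := exists_expBound_AMinus ξ η
  exact h.sumKernel.isHSKernel

theorem isHSKernel_tensorKernel_AMinus_APlus (ξ η : ℝ) :
    IsHSKernel (tensorKernel (AMinus ξ η) (APlus ξ η)) := by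
  obtain ⟨C, h⟩ := exists_expBound_APlus ξ η
  obtain ⟨D, h'⟩ := exists_expBound_AMinus ξ η
  exact (h'.tensorKernel h).isHSKernel

/-- The operator with kernel `A₊(v₁ + v₂)`. -/
def plusOp (ξ η : ℝ) : L2Pos →L[ℝ] L2Pos := kernelOp (sumKernel (APlus ξ η))

/-- The operator with kernel `A₋(v₁ + v₂)`. -/
def minusOp (ξ η : ℝ) : L2Pos →L[ℝ] L2Pos := kernelOp (sumKernel (AMinus ξ η))

theorem oneSubKStar_eq (ξ η : ℝ) : oneSubKStar ξ η = 1 - minusOp ξ η * plusOp ξ η := by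
  rw [oneSubKStar, KOp, ContinuousLinearMap.adjoint_comp,
    adjoint_kernelOp (isHSKernel_sumKernel_APlus ξ η) (sumKernel_comm _),
    adjoint_kernelOp (isHSKernel_sumKernel_AMinus ξ η) (sumKernel_comm _)]
  rfl

/-- The scalar factor between `exp (± η v) Ai (ξ + η² + v)` and `A_±(v)`. -/
def conjFactor (ξ η : ℝ) : ℝ := Real.exp (ξ * η + 2 * η ^ 3 / 3)

theorem conjFactor_mul_AMinus (ξ η v : ℝ) :
    conjFactor ξ η * AMinus ξ η v = Real.exp (-(η * v)) * airyAi (ξ + η ^ 2 + v) := by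
  rw [conjFactor, AMinus, mul_left_comm, ← Real.exp_add, mul_comm]
  congr 2
  ring

theorem exp_mul_APlus (ξ η v : ℝ) :
    Real.exp (-(η * v)) * APlus ξ η v = conjFactor ξ η * airyAi (ξ + η ^ 2 + v) := by
  rw [conjFactor, APlus, mul_left_comm, ← Real.exp_add, mul_comm]
  congr 2
  ring

theorem mulExp_mul_airyHankel_mul_mulExp (ξ : ℝ) {η : ℝ} (hη : 0 ≤ η) :
    mulExp η hη * airyHankel (ξ + η ^ 2) * mulExp η hη = conjFactor ξ η • minusOp ξ η := by
  have h := isHSKernel_sumKernel_AMinus ξ η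
  rw [minusOp, ← kernelOp_const_mul _ h]
  refine mulExp_comp_kernelOp_comp_mulExp hη (isHSKernel_sumKernel_airyAi _)
    (MemLp.const_mul h _) fun x y => ?_
  rw [sumKernel, sumKernel, conjFactor_mul_AMinus, mul_add, neg_add, Real.exp_add]
  ring

theorem mulExp_mul_plusOp_mul_mulExp (ξ : ℝ) {η : ℝ} (hη : 0 ≤ η) :
    mulExp η hη * plusOp ξ η * mulExp η hη = conjFactor ξ η • airyHankel (ξ + η ^ 2) := by
  have h := isHSKernel_sumKernel_airyAi (ξ + η ^ 2)
  rw [airyHankel, ← kernelOp_const_mul _ h]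
  refine mulExp_comp_kernelOp_comp_mulExp hη (isHSKernel_sumKernel_APlus ξ η)
    (MemLp.const_mul h _) fun x y => ?_
  rw [sumKernel, sumKernel, ← exp_mul_APlus, mul_add, neg_add, Real.exp_add]
  ring

theorem mulExp_toLp_APlus (ξ : ℝ) {η : ℝ} (hη : 0 ≤ η) :
    mulExp η hη (memLp_APlus ξ η).toLp = conjFactor ξ η • airyVec (ξ + η ^ 2) := by
  apply Lp.ext
  filter_upwards [mulExp_apply_ae hη (memLp_APlus ξ η).toLp, (memLp_APlus ξ η).coeFn_toLp,
    Lp.coeFn_smul (conjFactor ξ η) (airyVec (ξ + η ^ 2)),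
    (memLp_airyAi_shift (ξ + η ^ 2)).coeFn_toLp] with v h1 h2 h3 h4
  rw [h1, h2, h3, Pi.smul_apply, exp_mul_APlus, airyVec, h4, smul_eq_mul]

theorem smul_toLp_AMinus (ξ : ℝ) {η : ℝ} (hη : 0 ≤ η) :
    conjFactor ξ η • (memLp_AMinus ξ η).toLp = mulExp η hη (airyVec (ξ + η ^ 2)) := by
  apply Lp.ext
  filter_upwards [mulExp_apply_ae hη (airyVec (ξ + η ^ 2)), (memLp_AMinus ξ η).coeFn_toLp,
    Lp.coeFn_smul (conjFactor ξ η) (memLp_AMinus ξ η).toLp,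
    (memLp_airyAi_shift (ξ + η ^ 2)).coeFn_toLp] with v h1 h2 h3 h4
  rw [h1, h3, Pi.smul_apply, h2, smul_eq_mul, conjFactor_mul_AMinus, airyVec, h4]

theorem inner_resolvent_of_nonneg (ξ : ℝ) {η : ℝ} (hη : 0 ≤ η) :
    IsUnit (1 - minusOp ξ η * plusOp ξ η) ∧
      inner ℝ (memLp_APlus ξ η).toLp
        (Ring.inverse (1 - minusOp ξ η * plusOp ξ η) (memLp_AMinus ξ η).toLp) =
        airyLogDeriv (ξ + η ^ 2) := by
  set κ := conjFactor ξ η with hκ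
  have hκ0 : κ ≠ 0 := (Real.exp_pos _).ne'
  set M := mulExp η hη with hM
  set S := airyHankel (ξ + η ^ 2) with hS
  -- Chosen so that `M b = 𝐀₋ 𝐀₊`, using `κ 𝐀₋ = M S M`, while `b M = S²` is the Airy operator,
  -- using `M 𝐀₊ M = κ S`. The resolvents of `M b` and `b M` are then intertwined by `M`.
  set b := κ⁻¹ • (S * M * plusOp ξ η) with hb
  have hab : minusOp ξ η * plusOp ξ η = M * b := by
    have h : minusOp ξ η = κ⁻¹ • (M * S * M) := by
      rw [mulExp_mul_airyHankel_mul_mulExp, smul_smul, inv_mul_cancel₀ hκ0, one_smul]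
    rw [h, hb, smul_mul_assoc, mul_smul_comm]
    simp only [mul_assoc]
  have hba : b * M = airyOp (ξ + η ^ 2) := by
    rw [hb, smul_mul_assoc, mul_assoc, mul_assoc, ← mul_assoc M, mulExp_mul_plusOp_mul_mulExp,
      mul_smul_comm, smul_smul, inv_mul_cancel₀ hκ0, one_smul, airyHankel_mul_airyHankel]
  have hu : IsUnit (1 - b * M) := by
    rw [hba]
    exact isUnit_one_sub_airyOp _
  rw [hab]
  refine ⟨isUnit_one_sub_mul_comm hu, ?_⟩
  have h1 : (memLp_AMinus ξ η).toLp = κ⁻¹ • M (airyVec (ξ + η ^ 2)) := by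
    rw [← smul_toLp_AMinus, smul_smul, inv_mul_cancel₀ hκ0, one_smul]
  -- `M` is pulled through the resolvent and moved to the other side of the inner product, where it
  -- turns `A₊` into `κ Ai`; the factors `κ⁻¹` and `κ` cancel.
  rw [h1, map_smul, ← mul_apply_eq_comp, ringInverse_one_sub_mul_comm hu, hba, mul_apply_eq_comp,
    inner_smul_right, hM, ← inner_mulExp_comm, mulExp_toLp_APlus, inner_smul_left, ← hκ]
  simp only [conj_trivial]
  rw [← mul_assoc, inv_mul_cancel₀ hκ0, one_mul]
  rfl

theorem inner_resolvent (ξ η : ℝ) :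
    IsUnit (1 - minusOp ξ η * plusOp ξ η) ∧
      inner ℝ (memLp_APlus ξ η).toLp
        (Ring.inverse (1 - minusOp ξ η * plusOp ξ η) (memLp_AMinus ξ η).toLp) =
        airyLogDeriv (ξ + η ^ 2) := by
  rcases le_total 0 η with hη | hη
  · exact inner_resolvent_of_nonneg ξ hη
  · obtain ⟨hu, h⟩ := inner_resolvent_of_nonneg ξ (neg_nonneg.2 hη)
    -- Changing the sign of `η` exchanges `A₊` and `A₋`, hence replaces `𝐀₋ 𝐀₊` by its adjoint;
    -- symmetry of the real inner product undoes the exchange.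
    have e1 : plusOp ξ η = minusOp ξ (-η) := by rw [plusOp, minusOp, APlus_eq_AMinus_neg]
    have e2 : minusOp ξ η = plusOp ξ (-η) := by rw [plusOp, minusOp, AMinus_eq_APlus_neg]
    have e3 : (memLp_APlus ξ η).toLp = (memLp_AMinus ξ (-η)).toLp :=
      MemLp.toLp_congr _ _ (by rw [APlus_eq_AMinus_neg])
    have e4 : (memLp_AMinus ξ η).toLp = (memLp_APlus ξ (-η)).toLp :=
      MemLp.toLp_congr _ _ (by rw [AMinus_eq_APlus_neg])
    rw [e1, e2, e3, e4]
    have hu' := isUnit_one_sub_mul_comm hu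
    refine ⟨hu', ?_⟩
    rw [neg_sq] at h
    rw [← h, ← inner_ringInverse_comm hu hu', real_inner_comm]
    refine inner_one_sub_comm fun f g => ?_
    rw [mul_apply_eq_comp, mul_apply_eq_comp, minusOp, plusOp,
      inner_kernelOp_comm (isHSKernel_sumKernel_AMinus _ _) (sumKernel_comm _),
      inner_kernelOp_comm (isHSKernel_sumKernel_APlus _ _) (sumKernel_comm _)]

/-! ### The two traces -/

theorem hasTrace_a0Op (ξ η : ℝ) : HasTrace (a0Op ξ η) (airyLogDeriv (ξ + η ^ 2)) := by
  rw [← (inner_resolvent ξ η).2, a0Op, oneSubKStar_eq]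
  exact hasTrace_comp_tensorKernel (isHSKernel_tensorKernel_AMinus_APlus ξ η) (memLp_AMinus ξ η)
    (memLp_APlus ξ η) _

theorem a0_eq (ξ η : ℝ) : a0 ξ η = airyLogDeriv (ξ + η ^ 2) := (hasTrace_a0Op ξ η).opTrace_eq

theorem AMinus_zero (ξ : ℝ) : AMinus ξ 0 = fun v => airyAi (ξ + v) := by
  ext v
  simp [AMinus]

theorem APlus_zero (ξ : ℝ) : APlus ξ 0 = fun v => airyAi (ξ + v) := by
  ext v
  simp [APlus]

theorem hasDerivAt_AMinus_zero (ξ v : ℝ) :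
    HasDerivAt (AMinus ξ 0) (deriv airyAi (ξ + v)) v := by
  rw [AMinus_zero]
  exact (hasDerivAt_airyAi (ξ + v)).comp_const_add ξ v

theorem signedDeriv_AMinus_zero (ξ : ℝ) :
    signedDeriv 1 (AMinus ξ 0) = fun v => -deriv airyAi (ξ + v) := by
  ext v
  rw [signedDeriv, iteratedDeriv_one, (hasDerivAt_AMinus_zero ξ v).deriv]
  ring

theorem isHSKernel_tensorKernel_signedDeriv (ξ : ℝ) :
    IsHSKernel (tensorKernel (signedDeriv 1 (AMinus ξ 0)) (APlus ξ 0)) := by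
  obtain ⟨C, -, h0, h1, -⟩ := exists_airyAi_bound
  rw [signedDeriv_AMinus_zero, APlus_zero]
  have hA := expBound_shift continuous_airyAi.measurable h0 ξ
  have hA' := expBound_shift (g := fun x => -deriv airyAi x) (C := C)
    continuous_deriv_airyAi.neg.measurable (fun x => by rw [abs_neg]; exact h1 x) ξ
  exact (hA'.tensorKernel hA).isHSKernel

theorem oneSubKStar_zero (ξ : ℝ) : oneSubKStar ξ 0 = 1 - airyOp ξ := by
  rw [oneSubKStar_eq, minusOp, plusOp, AMinus_zero, APlus_zero, ← airyHankel_mul_airyHankel,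
    airyHankel]

theorem hasTrace_a1Op (ξ : ℝ) : HasTrace (a1Op ξ 0)
    (-inner ℝ (airyDerivVec ξ) (airyResolvent ξ (airyVec ξ))) := by
  have hD : MemLp (fun v => -deriv airyAi (ξ + v)) 2 volPos := (memLp_deriv_airyAi_shift ξ).neg
  have hk := isHSKernel_tensorKernel_signedDeriv ξ
  rw [a1Op, oneSubKStar_zero]
  rw [signedDeriv_AMinus_zero, APlus_zero] at hk ⊢
  have h := hasTrace_comp_tensorKernel hk hD (memLp_airyAi_shift ξ) (airyResolvent ξ)
  have e : hD.toLp = -airyDerivVec ξ := (memLp_deriv_airyAi_shift ξ).toLp_neg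
  have e2 : inner ℝ (memLp_airyAi_shift ξ).toLp (airyResolvent ξ hD.toLp) =
      -inner ℝ (airyDerivVec ξ) (airyResolvent ξ (airyVec ξ)) := by
    -- The minus sign of `A₋⁽¹⁾` comes out, and symmetry of the resolvent moves it from `Ai'` to
    -- `Ai`.
    rw [e, map_neg, inner_neg_right, ← inner_airyResolvent_comm, real_inner_comm]
    rfl
  rwa [e2] at h

theorem a1_eq (ξ : ℝ) :
    a1 ξ 0 = -inner ℝ (airyDerivVec ξ) (airyResolvent ξ (airyVec ξ)) :=
  (hasTrace_a1Op ξ).opTrace_eq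

end

/-- The first three groups of conjuncts say that the objects in the two formulas are well defined
(no junk values); the last two conjuncts are the formulas. -/
theorem lemma1p2 :
    -- `F₂` is well defined, positive and twice differentiable
    (∀ x y : ℝ, IntegrableOn (fun s => airyAi (x + s) * airyAi (y + s)) (Ioi 0)) ∧
    (∀ ξ : ℝ, FredholmConverges (shiftedAiryKernel ξ)) ∧
    (∀ ξ : ℝ, 0 < F2 ξ) ∧
    Differentiable ℝ F2 ∧
    Differentiable ℝ (deriv F2) ∧
    -- `a₀(ξ₂, η₂)` is well defined
    (∀ ξ₂ η₂ : ℝ,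
      IsHSKernel (sumKernel (APlus ξ₂ η₂)) ∧
      IsHSKernel (sumKernel (AMinus ξ₂ η₂)) ∧
      IsHSKernel (tensorKernel (AMinus ξ₂ η₂) (APlus ξ₂ η₂)) ∧
      IsUnit (oneSubKStar ξ₂ η₂) ∧
      HasTrace (a0Op ξ₂ η₂) (a0 ξ₂ η₂)) ∧
    -- `a₁(ξ₂, 0)` is well defined
    (∀ ξ₂ : ℝ,
      Differentiable ℝ (AMinus ξ₂ 0) ∧
      IsHSKernel (tensorKernel (signedDeriv 1 (AMinus ξ₂ 0)) (APlus ξ₂ 0)) ∧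
      HasTrace (a1Op ξ₂ 0) (a1 ξ₂ 0)) ∧
    -- the two formulas
    (∀ ξ₂ η₂ : ℝ, a0 ξ₂ η₂ = deriv F2 (ξ₂ + η₂ ^ 2) / F2 (ξ₂ + η₂ ^ 2)) ∧
    (∀ ξ₂ : ℝ, a1 ξ₂ 0 = -(deriv (deriv F2) ξ₂) / (2 * F2 ξ₂)) := by
  refine ⟨integrableOn_airyAi_mul, fredholmConverges_shiftedAiryKernel, F2_pos,
    fun ξ => (hasDerivAt_F2 ξ).differentiableAt,
    fun ξ => (hasDerivAt_deriv_F2 ξ).differentiableAt, fun ξ η => ?_, fun ξ => ?_,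
    fun ξ η => ?_, fun ξ => ?_⟩
  · refine ⟨isHSKernel_sumKernel_APlus ξ η, isHSKernel_sumKernel_AMinus ξ η,
      isHSKernel_tensorKernel_AMinus_APlus ξ η, ?_, ?_⟩
    · rw [oneSubKStar_eq]
      exact (inner_resolvent ξ η).1
    · rw [a0_eq]
      exact hasTrace_a0Op ξ η
  · refine ⟨fun v => (hasDerivAt_AMinus_zero ξ v).differentiableAt,
      isHSKernel_tensorKernel_signedDeriv ξ, ?_⟩
    rw [a1_eq]
    exact hasTrace_a1Op ξ
  · rw [a0_eq, (hasDerivAt_F2 _).deriv, mul_div_cancel_left₀ _ (F2_pos _).ne']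
  · rw [a1_eq, (hasDerivAt_deriv_F2 ξ).deriv, neg_div,
      mul_div_cancel_left₀ _ (mul_pos two_pos (F2_pos ξ)).ne']
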